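/- Let $G\rightrightarrows M$ be a Lie groupoid with source $s$, target $t$ and units $1_y$ ($y\in M$), where $G$ and $M$ are smooth, Hausdorff, second countable manifolds and $n=\dim M$. For an open $U\subset M$ write $G_U=s^{-1}(U)\cap t^{-1}(U)$ for the arrows of the restriction $G_U\rightrightarrows U$. Let $x\in M$ be a fixed point (the orbit of $x$ is $\{x\}$), and suppose that $G$ is proper at $x$: every sequence $(g_i)$ in $G$ with $(t(g_i),s(g_i))\to(x,x)$ in $M\times M$ has a convergent subsequence. Let $G_x=s^{-1}(x)\cap t^{-1}(x)$ be the isotropy group at $x$; it is a Lie group, embedded in $G$ as a submanifold. Then there is an open neighbourhood $W$ of $x$ such that every neighbourhood of $x$ contains an open $U\ni x$ with the following properties: 1. $U\subset W$ and $U$ is saturated in the restricted groupoid $G_W\rightrightarrows W$, that is, every arrow of $G$ with source in $U$ and target in $W$ has its target in $U$; 2. there are a diffeomorphism $\psi:U\to\mathbb{R}^n$ and a diffeomorphism $\Phi:G_U\to G_x\times\mathbb{R}^n$ such that $\Phi(g)=(g,0)$ for all $g\in G_x$, $\operatorname{pr}_2(\Phi(g))=\psi(s(g))$ for all $g\in G_U$,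 and $\Phi(1_y)=(1,\psi(y))$ for all $y\in U$. So, identifying $U$ with $\mathbb{R}^n$ by $\psi$, the source becomes the projection $G_x\times\mathbb{R}^n\to\mathbb{R}^n$ and the units become $1\times\mathbb{R}^n$. -/

import Mathlib

open scoped Manifold ContDiff Topology

/-- A map `f : X → Y` is proper at the point `y`: every sequence in `X` whose image converges to `y`
has a convergent subsequence. -/
def ProperAtPoint {X Y : Type*} [TopologicalSpace X] [TopologicalSpace Y] (f : X → Y) (y : Y) :
    Prop :=
  ∀ a : ℕ → X, Filter.Tendsto (fun i => f (a i)) Filter.atTop (𝓝 y) →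
    ∃ (b : X) (φ : ℕ → ℕ), StrictMono φ ∧ Filter.Tendsto (fun i => a (φ i)) Filter.atTop (𝓝 b)

/-- A Lie groupoid `G ⇉ M`, where `M` is an `n`-dimensional and `G` an `m`-dimensional smooth
manifold. The arrow `g` goes from `source g` to `target g`, and `mul g h _` is the composite `g h`,
defined when `source g = target h`. -/
structure LieGroupoid (n m : ℕ)
    (M : Type*) [TopologicalSpace M] [ChartedSpace (EuclideanSpace ℝ (Fin n)) M]
    (G : Type*) [TopologicalSpace G] [ChartedSpace (EuclideanSpace ℝ (Fin m)) G] where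
  source : G → M
  target : G → M
  unit : M → G
  inv : G → G
  mul : ∀ g h : G, source g = target h → G
  source_submersion : Manifold.IsSubmersion (𝓡 m) (𝓡 n) ∞ source
  target_submersion : Manifold.IsSubmersion (𝓡 m) (𝓡 n) ∞ target
  unit_smooth : ContMDiff (𝓡 n) (𝓡 m) ∞ unit
  inv_smooth : ContMDiff (𝓡 m) (𝓡 m) ∞ inv
  /-- The multiplication is smooth on the submanifold `{(g, h) | source g = target h}` of `G × G`:
  around each of its points it extends to a smooth map on an open subset of `G × G`. -/
  mul_smooth : ∀ p : G × G, source p.1 = target p.2 →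
    ∃ (O : Set (G × G)) (f : G × G → G), IsOpen O ∧ p ∈ O ∧
      ContMDiffOn ((𝓡 m).prod (𝓡 m)) (𝓡 m) ∞ f O ∧
      ∀ q ∈ O, ∀ hq : source q.1 = target q.2, f q = mul q.1 q.2 hq
  source_mul : ∀ g h (e : source g = target h), source (mul g h e) = source h
  target_mul : ∀ g h (e : source g = target h), target (mul g h e) = target g
  mul_assoc : ∀ g h k (e₁ : source g = target h) (e₂ : source h = target k),
    mul (mul g h e₁) k ((source_mul g h e₁).trans e₂) =
      mul g (mul h k e₂) (e₁.trans (target_mul h k e₂).symm)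
  source_unit : ∀ x, source (unit x) = x
  target_unit : ∀ x, target (unit x) = x
  mul_unit : ∀ g, mul g (unit (source g)) (target_unit (source g)).symm = g
  unit_mul : ∀ g, mul (unit (target g)) g (source_unit (target g)) = g
  source_inv : ∀ g, source (inv g) = target g
  target_inv : ∀ g, target (inv g) = source g
  mul_inv : ∀ g, mul g (inv g) (target_inv g).symm = unit (target g)
  inv_mul : ∀ g, mul (inv g) g (source_inv g) = unit (source g)

namespace LieGroupoid

variable {n m : ℕ}
  {M : Type*} [TopologicalSpace M] [ChartedSpace (EuclideanSpace ℝ (Fin n)) M]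
  {G : Type*} [TopologicalSpace G] [ChartedSpace (EuclideanSpace ℝ (Fin m)) G]
  (𝒢 : LieGroupoid n m M G)

/-- The orbit of `x`. -/
def orbit (x : M) : Set M := {y | ∃ g, 𝒢.source g = x ∧ 𝒢.target g = y}

/-- `x` is a fixed point if its orbit is reduced to `x`. -/
def IsFixedPoint (x : M) : Prop := 𝒢.orbit x = {x}

/-- The anchor map `ρ = (t, s)`. -/
def anchor (g : G) : M × M := (𝒢.target g, 𝒢.source g)

/-- The Lie groupoid is proper at `x` if its anchor is proper at `(x, x)`. -/
def IsProperAt (x : M) : Prop := ProperAtPoint 𝒢.anchor (x, x)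

/-- The isotropy group `G_x` of arrows from `x` to `x`, with the topology induced by `G`. -/
def Isotropy (x : M) : Type _ := {g : G // 𝒢.source g = x ∧ 𝒢.target g = x}

instance (x : M) : TopologicalSpace (𝒢.Isotropy x) :=
  inferInstanceAs (TopologicalSpace {g : G // 𝒢.source g = x ∧ 𝒢.target g = x})

/-- The inclusion `G_x → G`. -/
def isotropyIncl (x : M) (g : 𝒢.Isotropy x) : G := g.1

/-- The group structure of `G_x` given by composition of arrows. -/
instance (x : M) : Group (𝒢.Isotropy x) where
  mul g h := ⟨𝒢.mul g.1 h.1 (g.2.1.trans h.2.2.symm),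
    (𝒢.source_mul _ _ _).trans h.2.1, (𝒢.target_mul _ _ _).trans g.2.2⟩
  one := ⟨𝒢.unit x, 𝒢.source_unit x, 𝒢.target_unit x⟩
  inv g := ⟨𝒢.inv g.1, (𝒢.source_inv _).trans g.2.2, (𝒢.target_inv _).trans g.2.1⟩
  mul_assoc g h k := Subtype.ext (𝒢.mul_assoc g.1 h.1 k.1 _ _)
  one_mul := by
    rintro ⟨g, hs, rfl⟩
    exact Subtype.ext (𝒢.unit_mul g)
  mul_one := by
    rintro ⟨g, rfl, ht⟩
    exact Subtype.ext (𝒢.mul_unit g)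
  inv_mul_cancel := by
    rintro ⟨g, rfl, ht⟩
    exact Subtype.ext (𝒢.inv_mul g)

/-- The arrows `G_U = s⁻¹(U) ∩ t⁻¹(U)` of the restriction of `G` to an open subset `U` of `M`, an
open subset (hence an open submanifold) of `G`. -/
def restrict (U : TopologicalSpace.Opens M) : TopologicalSpace.Opens G :=
  ⟨𝒢.source ⁻¹' U ∩ 𝒢.target ⁻¹' U,
    (U.isOpen.preimage 𝒢.source_submersion.contMDiff.continuous).inter
      (U.isOpen.preimage 𝒢.target_submersion.contMDiff.continuous)⟩

/-- The source map `G_U → U`. -/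
def restrictSource (U : TopologicalSpace.Opens M) (g : 𝒢.restrict U) : U :=
  ⟨𝒢.source g, g.2.1⟩

/-- The unit map `U → G_U`. -/
def restrictUnit (U : TopologicalSpace.Opens M) (y : U) : 𝒢.restrict U :=
  ⟨𝒢.unit y, Set.mem_preimage.mpr (by rw [𝒢.source_unit]; exact y.2),
    Set.mem_preimage.mpr (by rw [𝒢.target_unit]; exact y.2)⟩

/-- The inclusion `G_x → G_U` for a point `x` of `U`. -/
def isotropyToRestrict (U : TopologicalSpace.Opens M) {x : M} (hx : x ∈ U) (g : 𝒢.Isotropy x) :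
    𝒢.restrict U :=
  ⟨g.1, Set.mem_preimage.mpr (by rw [g.2.1]; exact hx),
    Set.mem_preimage.mpr (by rw [g.2.2]; exact hx)⟩

/-- `U` is a saturated subset of the restriction `G_W ⇉ W`: it is contained in `W`, and every arrow
of `G_W` whose source lies in `U` has its target in `U`. -/
def IsSaturatedIn (U W : Set M) : Prop :=
  U ⊆ W ∧ ∀ g : G, 𝒢.source g ∈ U → 𝒢.target g ∈ W → 𝒢.target g ∈ U

end LieGroupoid

/-! Since `x` is fixed, `G_x` is the whole fibre `s⁻¹(x)` of a submersion, hence embedded, and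
properness makes it compact. A compact embedded Lie group is a smooth retract of a neighbourhood
(`exists_isRetractionOn`), and the retraction `r` can be corrected so that it sends all units to
`1`. In a chart `c` of `M` centred at `x`, the map `f = (r, c ∘ s)` is a local diffeomorphism along
`G_x` and injective there, so by compactness it is an injective local diffeomorphism on an open `V ⊇
G_x` (`exists_trivialization`). Properness also puts in `V` every arrow with both ends near `x`.

Take for `W` a small ball in the chart. For small `ρ`, let `Ω` be the set of `z` in this ball such
that every arrow of `V` starting at `z` ends in the ball of radius `ρ`, and let `U` correspond to
`Ω`. Compactness of `G_x` makes `Ω` open (`eventually_forall_exists_mem_eq`), composition of arrows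
makes `U` saturated in `W`, and the units show that `Ω` lies in the ball of radius `ρ`.

Moreover `Ω` is star-shaped: in suitable coordinates near `G_x`, the norm of the target does not
decrease when the source moves outwards along a ray (`exists_norm_le_norm_of_ray`). This holds
because the target vanishes on `G_x` and, by inversion of arrows, is bounded below by a multiple of
the source. A radial stretching `θ` identifies `Ω` with `ℝⁿ` (`exists_bijOn_univ_of_starShaped`);
then `ψ = θ ∘ c` and `Φ = (r, θ ∘ c ∘ s)`. -/

/-! ### Local diffeomorphisms and the inverse function theorem. -/

noncomputable section LocalDiffeomorphisms

open TopologicalSpace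

variable {E : Type*} [NormedAddCommGroup E] [NormedSpace ℝ E]
  {F : Type*} [NormedAddCommGroup F] [NormedSpace ℝ F]
  {M : Type*} [TopologicalSpace M] [ChartedSpace E M]
  {N : Type*} [TopologicalSpace N] [ChartedSpace F N]

/-- A chart of the maximal atlas, as a partial diffeomorphism to the model space. -/
def PartialDiffeomorph.ofMemMaximalAtlas [IsManifold 𝓘(ℝ, E) ∞ M] (e : OpenPartialHomeomorph M E)
    (he : e ∈ IsManifold.maximalAtlas 𝓘(ℝ, E) ∞ M) :
    PartialDiffeomorph 𝓘(ℝ, E) 𝓘(ℝ, E) M E ∞ where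
  toPartialEquiv := e.toPartialEquiv
  open_source := e.open_source
  open_target := e.open_target
  contMDiffOn_toFun := contMDiffOn_of_mem_maximalAtlas he
  contMDiffOn_invFun := contMDiffOn_symm_of_mem_maximalAtlas he

theorem isLocalDiffeomorphAt_chartAt [IsManifold 𝓘(ℝ, E) ∞ M] {x y : M}
    (hy : y ∈ (chartAt E x).source) :
    IsLocalDiffeomorphAt 𝓘(ℝ, E) 𝓘(ℝ, E) ∞ (chartAt E x) y :=
  ⟨.ofMemMaximalAtlas _ (IsManifold.chart_mem_maximalAtlas x), hy, fun _ _ => rfl⟩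

theorem isLocalDiffeomorphAt_chartAt_symm [IsManifold 𝓘(ℝ, E) ∞ M] {x : M} {y : E}
    (hy : y ∈ (chartAt E x).target) :
    IsLocalDiffeomorphAt 𝓘(ℝ, E) 𝓘(ℝ, E) ∞ (chartAt E x).symm y :=
  ⟨(PartialDiffeomorph.ofMemMaximalAtlas _ (IsManifold.chart_mem_maximalAtlas x)).symm, hy,
    fun _ _ => rfl⟩

section Restriction

variable {E₁ E₂ H₁ H₂ M₁ M₂ : Type*} [NormedAddCommGroup E₁] [NormedSpace ℝ E₁]
  [TopologicalSpace H₁] {I : ModelWithCorners ℝ E₁ H₁} [TopologicalSpace M₁] [ChartedSpace H₁ M₁]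
  [NormedAddCommGroup E₂] [NormedSpace ℝ E₂]
  [TopologicalSpace H₂] {J : ModelWithCorners ℝ E₂ H₂} [TopologicalSpace M₂] [ChartedSpace H₂ M₂]

/-- The restriction of a partial diffeomorphism to an open set. -/
def PartialDiffeomorph.restrOpen (Φ : PartialDiffeomorph I J M₁ M₂ ∞) (O : Set M₁)
    (hO : IsOpen O) : PartialDiffeomorph I J M₁ M₂ ∞ where
  toPartialEquiv := (Φ.toOpenPartialHomeomorph.restrOpen O hO).toPartialEquiv
  open_source := (Φ.toOpenPartialHomeomorph.restrOpen O hO).open_source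
  open_target := (Φ.toOpenPartialHomeomorph.restrOpen O hO).open_target
  contMDiffOn_toFun := Φ.contMDiffOn_toFun.mono fun _ hy => hy.1
  contMDiffOn_invFun := Φ.contMDiffOn_invFun.mono fun _ hy => hy.1

theorem IsLocalDiffeomorphAt.congr_of_eventuallyEq {f g : M₁ → M₂} {x : M₁}
    (hf : IsLocalDiffeomorphAt I J ∞ f x) (h : g =ᶠ[𝓝 x] f) :
    IsLocalDiffeomorphAt I J ∞ g x := by
  obtain ⟨Φ, hx, hΦ⟩ := hf
  obtain ⟨O, hO, hOo, hxO⟩ := eventually_nhds_iff.1 h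
  exact ⟨Φ.restrOpen O hOo, ⟨hx, hxO⟩, fun y hy => (hO y hy.2).trans (hΦ hy.1)⟩

end Restriction

/-- The inclusion of an open submanifold is a local diffeomorphism. -/
theorem isLocalDiffeomorphAt_subtype_val [IsManifold 𝓘(ℝ, E) ∞ M] (U : Opens M) (y : U) :
    IsLocalDiffeomorphAt 𝓘(ℝ, E) 𝓘(ℝ, E) ∞ (Subtype.val : U → M) y := by
  let e := U.openPartialHomeomorphSubtypeCoe ⟨y⟩
  refine ⟨⟨e.toPartialEquiv, e.open_source, e.open_target, ?_, ?_⟩, ?_, ?_⟩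
  · exact contMDiff_subtype_val.contMDiffOn
  · intro z hz
    refine ContMDiffAt.contMDiffWithinAt ?_
    rw [← ContMDiffAt.subtypeVal_comp_iff]
    refine contMDiffAt_id.congr_of_eventuallyEq ?_
    filter_upwards [e.open_target.mem_nhds hz] with w hw
    exact e.right_inv hw
  · simp [e]
  · intro z _; rfl

theorem isLocalDiffeomorphAt_prodMap {E₁ E₂ F₁ F₂ : Type*}
    [NormedAddCommGroup E₁] [NormedSpace ℝ E₁] [NormedAddCommGroup E₂] [NormedSpace ℝ E₂]
    [NormedAddCommGroup F₁] [NormedSpace ℝ F₁] [NormedAddCommGroup F₂] [NormedSpace ℝ F₂]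
    {M₁ M₂ N₁ N₂ : Type*}
    [TopologicalSpace M₁] [ChartedSpace E₁ M₁] [TopologicalSpace M₂] [ChartedSpace E₂ M₂]
    [TopologicalSpace N₁] [ChartedSpace F₁ N₁] [TopologicalSpace N₂] [ChartedSpace F₂ N₂]
    {f : M₁ → N₁} {g : M₂ → N₂} {p : M₁ × M₂}
    (hf : IsLocalDiffeomorphAt 𝓘(ℝ, E₁) 𝓘(ℝ, F₁) ∞ f p.1)
    (hg : IsLocalDiffeomorphAt 𝓘(ℝ, E₂) 𝓘(ℝ, F₂) ∞ g p.2) :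
    IsLocalDiffeomorphAt (𝓘(ℝ, E₁).prod 𝓘(ℝ, E₂)) (𝓘(ℝ, F₁).prod 𝓘(ℝ, F₂)) ∞
      (Prod.map f g) p := by
  obtain ⟨Φ, hΦ, hf⟩ := hf
  obtain ⟨Ψ, hΨ, hg⟩ := hg
  let e := Φ.toOpenPartialHomeomorph.prod Ψ.toOpenPartialHomeomorph
  refine ⟨⟨e.toPartialEquiv, e.open_source, e.open_target, ?_, ?_⟩, ⟨hΦ, hΨ⟩, ?_⟩
  · exact Φ.contMDiffOn_toFun.prodMap Ψ.contMDiffOn_toFun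
  · exact Φ.contMDiffOn_invFun.prodMap Ψ.contMDiffOn_invFun
  · exact fun q hq => Prod.ext (hf hq.1) (hg hq.2)

theorem isLocalDiffeomorphAt_id {H : Type*} [TopologicalSpace H] {I : ModelWithCorners ℝ E H}
    {M : Type*} [TopologicalSpace M] [ChartedSpace H M] (x : M) :
    IsLocalDiffeomorphAt I I ∞ (id : M → M) x :=
  (Diffeomorph.refl I M ∞).isLocalDiffeomorph x

variable (E F) in
/-- The identity of `E × F`, from its structure of manifold modelled on the vector space `E × F` to
its structure of product manifold. -/
def Diffeomorph.prodSelf :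
    Diffeomorph 𝓘(ℝ, E × F) (𝓘(ℝ, E).prod 𝓘(ℝ, F)) (E × F) (E × F) ∞ where
  toEquiv := Equiv.refl _
  contMDiff_toFun := (contDiff_fst.contMDiff).prodMk (contDiff_snd.contMDiff)
  contMDiff_invFun := by
    exact ContMDiff.prodMk_space contMDiff_fst contMDiff_snd

/-- The inverse function theorem: a smooth map between Banach spaces is a local diffeomorphism at
each point where its derivative is invertible. -/
theorem ContDiffOn.isLocalDiffeomorphAt [CompleteSpace E] {f : E → F} {O : Set E} (hO : IsOpen O)
    (hf : ContDiffOn ℝ ∞ f O) {a : E} (ha : a ∈ O) (f' : E ≃L[ℝ] F)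
    (hf' : HasFDerivAt f (f' : E →L[ℝ] F) a) :
    IsLocalDiffeomorphAt 𝓘(ℝ, E) 𝓘(ℝ, F) ∞ f a := by
  have hfa : ContDiffAt ℝ ∞ f a := hf.contDiffAt (hO.mem_nhds ha)
  let e := hfa.toOpenPartialHomeomorph f hf' (by simp)
  have hea : a ∈ e.source := hfa.mem_toOpenPartialHomeomorph_source hf' (by simp)
  have hef : ⇑e = f := rfl
  have hcont : ContinuousOn (fderiv ℝ f) O := hf.continuousOn_fderiv_of_isOpen hO (by simp)
  -- The inverse must be smooth on its whole domain, not only at `f a`; hence the restriction to the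
  -- open set where the derivative is invertible.
  let O' := O ∩ fderiv ℝ f ⁻¹' Set.range ((↑) : (E ≃L[ℝ] F) → E →L[ℝ] F)
  have hO' : IsOpen O' := hcont.isOpen_inter_preimage hO (ContinuousLinearEquiv.isOpen)
  let e' := e.restrOpen O' hO'
  refine ⟨⟨e'.toPartialEquiv, e'.open_source, e'.open_target, ?_, ?_⟩, ⟨hea, ha, f', hf'.fderiv.symm⟩,
    fun _ _ => rfl⟩
  · exact (contMDiffOn_iff_contDiffOn.2 hf).mono fun y hy => hy.2.1
  · refine contMDiffOn_iff_contDiffOn.2 fun y hy => ContDiffAt.contDiffWithinAt ?_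
    have hs : e'.symm y ∈ e'.source := e'.map_target hy
    obtain ⟨g', hg'⟩ := hs.2.2
    have hfy : ContDiffAt ℝ ∞ f (e'.symm y) := hf.contDiffAt (hO.mem_nhds hs.2.1)
    refine e'.contDiffAt_symm (f₀' := g') hy ?_ hfy
    rw [hg']
    exact (hfy.differentiableAt (by simp)).hasFDerivAt

end LocalDiffeomorphisms

/-! ### Normal form of submersions. -/

/-- Around each point, a submersion is a linear projection, in suitable coordinates on its source and
in given coordinates on its target. -/
theorem Manifold.IsSubmersionOfComplement.exists_partialDiffeomorph_snd_eq
    {A B E : Type*} [NormedAddCommGroup A] [NormedSpace ℝ A] [NormedAddCommGroup B]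
    [NormedSpace ℝ B] [NormedAddCommGroup E] [NormedSpace ℝ E] [CompleteSpace E]
    {M : Type*} [TopologicalSpace M] [ChartedSpace B M] [IsManifold 𝓘(ℝ, B) ∞ M]
    {G : Type*} [TopologicalSpace G] [ChartedSpace E G] [IsManifold 𝓘(ℝ, E) ∞ G]
    {s : G → M} (hs : Manifold.IsSubmersionOfComplement A 𝓘(ℝ, E) 𝓘(ℝ, B) ∞ s)
    (c : PartialDiffeomorph 𝓘(ℝ, B) 𝓘(ℝ, B) M B ∞) {g₀ : G} (hg₀ : s g₀ ∈ c.source) :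
    ∃ e : PartialDiffeomorph 𝓘(ℝ, E) 𝓘(ℝ, A × B) G (A × B) ∞, g₀ ∈ e.source ∧
      ∀ g ∈ e.source, s g ∈ c.source ∧ (e g).2 = c (s g) := by
  have hsc : Continuous s := hs.contMDiff.continuous
  let h := hs g₀
  let φ := PartialDiffeomorph.ofMemMaximalAtlas _ h.domChart_mem_maximalAtlas
  let ψ := PartialDiffeomorph.ofMemMaximalAtlas _ h.codChart_mem_maximalAtlas
  have hφ : g₀ ∈ φ.source := h.mem_domChart_source
  have hψ : ∀ g ∈ φ.source, s g ∈ ψ.source := h.source_subset_preimage_source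
  have hL : ∀ g ∈ φ.source, ψ (s g) = (h.equiv (φ g)).1 := by
    intro g hg
    have hmem : φ g ∈ (h.domChart.extend 𝓘(ℝ, E)).target := by
      rw [OpenPartialHomeomorph.extend_target]
      exact ⟨φ.map_source hg, φ g, rfl⟩
    have := h.writtenInCharts hmem
    have h2 : h.domChart.symm (φ g) = g := h.domChart.left_inv hg
    change h.codChart (s g) = _
    simpa [h2] using this
  let f : G → A × B := fun g => ((h.equiv (φ g)).2, c (s g))
  -- The normal form comes with its own chart `ψ` on the target; the transition `c ∘ ψ.symm` on the
  -- factor `B` replaces it by `c`.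
  have hmap : IsLocalDiffeomorphAt (𝓘(ℝ, B).prod 𝓘(ℝ, A)) (𝓘(ℝ, B).prod 𝓘(ℝ, A)) ∞
      (Prod.map (c ∘ ψ.symm) id) (h.equiv (φ g₀)) := by
    refine isLocalDiffeomorphAt_prodMap ?_ (isLocalDiffeomorphAt_id _)
    have hs0 : ψ.symm (h.equiv (φ g₀)).1 = s g₀ := by
      rw [← hL _ hφ]; exact ψ.left_inv (hψ _ hφ)
    refine IsLocalDiffeomorphAt.comp (J := 𝓘(ℝ, B)) _ _ (ψ.symm.isLocalDiffeomorphAt _ _ _ ?_) ?_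
    · rw [← hL _ hφ]; exact ψ.map_source (hψ _ hφ)
    · rw [hs0]; exact c.isLocalDiffeomorphAt _ _ _ hg₀
  have hf : IsLocalDiffeomorphAt 𝓘(ℝ, E) 𝓘(ℝ, A × B) ∞ f g₀ := by
    have h1 : IsLocalDiffeomorphAt 𝓘(ℝ, E) 𝓘(ℝ, E) ∞ φ g₀ := φ.isLocalDiffeomorphAt _ _ _ hφ
    have h2 := h1.comp 𝓘(ℝ, B × A) _ (h.equiv.toDiffeomorph.isLocalDiffeomorph (φ g₀))
    have h3 := h2.comp _ _ ((Diffeomorph.prodSelf B A).isLocalDiffeomorph _)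
    have h4 := h3.comp _ _ hmap
    have h5 := h4.comp _ _ ((Diffeomorph.prodComm 𝓘(ℝ, B) 𝓘(ℝ, A) B A ∞).isLocalDiffeomorph _)
    have h6 := h5.comp _ _ ((Diffeomorph.prodSelf A B).symm.isLocalDiffeomorph _)
    refine h6.congr_of_eventuallyEq ?_
    filter_upwards [φ.open_source.mem_nhds hφ] with g hg
    refine Prod.ext rfl ?_
    change c (s g) = c (ψ.symm (h.equiv (φ g)).1)
    rw [← hL g hg]
    exact congrArg c (ψ.left_inv (hψ g hg)).symm
  obtain ⟨Φ, hΦ, hfΦ⟩ := hf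
  refine ⟨Φ.restrOpen (s ⁻¹' c.source) (c.open_source.preimage hsc), ⟨hΦ, hg₀⟩,
    fun g hg => ⟨hg.2, ?_⟩⟩
  exact (congrArg Prod.snd (hfΦ hg.1)).symm

/-! ### Embedded submanifolds from slice charts. -/

noncomputable section SliceCharts

variable {A B E : Type*} [NormedAddCommGroup A] [NormedSpace ℝ A] [NormedAddCommGroup B]
    [NormedSpace ℝ B] [NormedAddCommGroup E] [NormedSpace ℝ E]
    {G : Type*} [TopologicalSpace G] [ChartedSpace E G]
    {K : Type*} {ι : K → G}

variable (A B E) in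
/-- A slice chart for a map `ι : K → G`: a chart of `G` with values in `A × B` in which the range of
`ι` is `A × 0`. -/
structure SliceChart (ι : K → G) extends PartialDiffeomorph 𝓘(ℝ, E) 𝓘(ℝ, A × B) G (A × B) ∞ where
  mem_range_iff : ∀ g ∈ source, g ∈ Set.range ι ↔ (toFun g).2 = 0

namespace SliceChart

/-- The underlying map of a slice chart. -/
def map (σ : SliceChart A B E ι) : G → A × B := σ.toPartialDiffeomorph

/-- The inverse of a slice chart. -/
def inv (σ : SliceChart A B E ι) : A × B → G := σ.toPartialDiffeomorph.symm

theorem contMDiffOn_map (σ : SliceChart A B E ι) :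
    ContMDiffOn 𝓘(ℝ, E) 𝓘(ℝ, A × B) ∞ σ.map σ.source := σ.contMDiffOn_toFun

theorem contMDiffOn_inv (σ : SliceChart A B E ι) :
    ContMDiffOn 𝓘(ℝ, A × B) 𝓘(ℝ, E) ∞ σ.inv σ.target := σ.contMDiffOn_invFun

theorem inv_map (σ : SliceChart A B E ι) {g : G} (hg : g ∈ σ.source) : σ.inv (σ.map g) = g :=
  σ.left_inv hg

theorem map_inv (σ : SliceChart A B E ι) {p : A × B} (hp : p ∈ σ.target) : σ.map (σ.inv p) = p :=
  σ.right_inv hp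

theorem map_mem (σ : SliceChart A B E ι) {g : G} (hg : g ∈ σ.source) : σ.map g ∈ σ.target :=
  σ.map_source hg

theorem inv_mem (σ : SliceChart A B E ι) {p : A × B} (hp : p ∈ σ.target) : σ.inv p ∈ σ.source :=
  σ.map_target hp

theorem map_apply (σ : SliceChart A B E ι) {h : K} (hh : ι h ∈ σ.source) :
    σ.map (ι h) = ((σ.map (ι h)).1, 0) :=
  Prod.ext rfl ((σ.mem_range_iff _ hh).1 ⟨h, rfl⟩)

theorem exists_of_mem (σ : SliceChart A B E ι) {a : A} (ha : (a, (0 : B)) ∈ σ.target) :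
    ∃ h, ι h = σ.inv (a, 0) := by
  refine (σ.mem_range_iff _ (σ.inv_mem ha)).2 ?_
  exact congrArg Prod.snd (σ.map_inv ha)

variable [TopologicalSpace K]

/-- The chart of `K` defined by a slice chart, when `ι` is an embedding. -/
def chart (σ : SliceChart A B E ι) (hι : Topology.IsEmbedding ι) [Nonempty K] :
    OpenPartialHomeomorph K A where
  toFun h := (σ.map (ι h)).1
  invFun a := Function.invFun ι (σ.inv (a, 0))
  source := ι ⁻¹' σ.source
  target := {a | (a, 0) ∈ σ.target}
  map_source' h hh := by
    change ((σ.map (ι h)).1, (0 : B)) ∈ σ.target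
    rw [← σ.map_apply hh]; exact σ.map_mem hh
  map_target' a ha := by
    change ι (Function.invFun ι (σ.inv (a, 0))) ∈ σ.source
    rw [Function.invFun_eq (σ.exists_of_mem ha)]
    exact σ.inv_mem ha
  left_inv' h hh := by
    rw [← σ.map_apply hh, σ.inv_map hh, Function.leftInverse_invFun hι.injective]
  right_inv' a ha := by
    rw [Function.invFun_eq (σ.exists_of_mem ha), σ.map_inv ha]
  open_source := σ.open_source.preimage hι.continuous
  open_target := σ.open_target.preimage (by fun_prop)
  continuousOn_toFun := continuous_fst.comp_continuousOn
    (σ.contMDiffOn_map.continuousOn.comp hι.continuous.continuousOn fun _ h => h)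
  continuousOn_invFun := by
    rw [hι.continuousOn_iff]
    refine (σ.contMDiffOn_inv.continuousOn.comp (f := fun a => (a, (0 : B)))
      (by fun_prop) fun _ h => h).congr fun a ha => ?_
    exact Function.invFun_eq (σ.exists_of_mem ha)

theorem apply_chart_symm (σ : SliceChart A B E ι) (hι : Topology.IsEmbedding ι) [Nonempty K] {a : A}
    (ha : a ∈ (σ.chart hι).target) : ι ((σ.chart hι).symm a) = σ.inv (a, 0) :=
  Function.invFun_eq (σ.exists_of_mem ha)

/-- The structure of charted space on an embedded space given by slice charts around its points. -/
@[reducible] def chartedSpace (σ : K → SliceChart A B E ι) (hι : Topology.IsEmbedding ι)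
    (hσ : ∀ h, ι h ∈ (σ h).source) : ChartedSpace A K where
  atlas := Set.range fun h => haveI : Nonempty K := ⟨h⟩; (σ h).chart hι
  chartAt h := haveI : Nonempty K := ⟨h⟩; (σ h).chart hι
  mem_chart_source h := hσ h
  chart_mem_atlas h := ⟨h, rfl⟩

variable (σ : K → SliceChart A B E ι) (hι : Topology.IsEmbedding ι) (hσ : ∀ h, ι h ∈ (σ h).source)

-- The transition maps are ambient ones, restricted to `A × 0` and projected to `A`.
include hσ in
theorem isManifold : letI := chartedSpace σ hι hσ; IsManifold 𝓘(ℝ, A) ∞ K := by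
  let _ := chartedSpace σ hι hσ
  refine isManifold_of_contDiffOn _ _ _ ?_
  rintro e e' ⟨h, rfl⟩ ⟨h', rfl⟩
  have : Nonempty K := ⟨h⟩
  simp only [modelWithCornersSelf_coe, modelWithCornersSelf_coe_symm, Set.range_id, Set.inter_univ,
    Set.preimage_id_eq, id_eq, Function.id_comp, Function.comp_id]
  rw [← contMDiffOn_iff_contDiffOn]
  have h1 : ContMDiffOn 𝓘(ℝ, A) 𝓘(ℝ, A) ∞ (fun a : A => ((σ h').map ((σ h).inv (a, 0))).1)
      (((σ h).chart hι).symm ≫ₕ (σ h').chart hι).source := by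
    refine contDiff_fst.contMDiff.comp_contMDiffOn ((σ h').contMDiffOn_map.comp
      ((σ h).contMDiffOn_inv.comp (t := (σ h).target) (f := fun a : A => (a, (0 : B)))
        (ContDiff.contMDiff (by fun_prop)).contMDiffOn ?_) ?_)
    · intro a ha; exact ha.1
    · intro a ha
      have := ha.2
      change ι (((σ h).chart hι).symm a) ∈ (σ h').source at this
      rwa [apply_chart_symm _ _ ha.1] at this
  refine h1.congr fun a ha => ?_
  change ((σ h').map (ι (((σ h).chart hι).symm a))).1 = _
  rw [apply_chart_symm _ _ ha.1]

/-- A map to an embedded submanifold is smooth if it is smooth as a map to the ambient manifold. -/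
theorem contMDiffAt_of_comp {E' H N : Type*} [NormedAddCommGroup E'] [NormedSpace ℝ E']
    [TopologicalSpace H] {I : ModelWithCorners ℝ E' H} [TopologicalSpace N] [ChartedSpace H N]
    {f : N → K} {p : N} (hf : ContMDiffAt I 𝓘(ℝ, E) ∞ (ι ∘ f) p) :
    letI := chartedSpace σ hι hσ; ContMDiffAt I 𝓘(ℝ, A) ∞ f p := by
  let _ := chartedSpace σ hι hσ
  rw [contMDiffAt_iff_target]
  refine ⟨hι.continuousAt_iff.2 hf.continuousAt, ?_⟩
  -- The chart of `K` at `f p` is the first component of the ambient slice chart composed with `ι`,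
  -- so only `ι ∘ f` matters.
  have h1 : ContMDiffAt 𝓘(ℝ, E) 𝓘(ℝ, A × B) ∞ (σ (f p)).map (ι (f p)) :=
    (σ (f p)).contMDiffOn_map.contMDiffAt ((σ (f p)).open_source.mem_nhds (hσ _))
  exact contDiff_fst.contMDiff.contMDiffAt.comp p (h1.comp p hf)

-- In the slice charts followed by `L`, the map `ι` reads `a ↦ L (a, 0)`.
include hσ in
theorem isImmersion [IsManifold 𝓘(ℝ, E) ∞ G] (L : (A × B) ≃L[ℝ] E) :
    letI := chartedSpace σ hι hσ; Manifold.IsImmersionOfComplement B 𝓘(ℝ, A) 𝓘(ℝ, E) ∞ ι := by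
  let _ := chartedSpace σ hι hσ
  have := isManifold σ hι hσ
  intro h
  have : Nonempty K := ⟨h⟩
  let e : OpenPartialHomeomorph G E :=
    (σ h).toOpenPartialHomeomorph.transHomeomorph L.toHomeomorph
  refine Manifold.IsImmersionAtOfComplement.mk_of_continuousAt hι.continuous.continuousAt L
    (chartAt A h) e (mem_chart_source A h) (hσ h) (IsManifold.chart_mem_maximalAtlas h) ?_ ?_
  · refine e.mem_maximalAtlas_of_contMDiffOn ?_ ?_
    · exact L.contDiff.contMDiff.comp_contMDiffOn (σ h).contMDiffOn_map
    · exact (σ h).contMDiffOn_inv.comp L.symm.contDiff.contMDiff.contMDiffOn fun y hy => hy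
  · intro a ha
    have ha' : a ∈ ((σ h).chart hι).target := by
      rw [OpenPartialHomeomorph.extend_target] at ha
      exact ha.1
    change L ((σ h).map (ι (((σ h).chart hι).symm a))) = L (a, 0)
    rw [apply_chart_symm _ _ ha', map_inv _ ha']

end SliceChart

end SliceCharts

/-! ### Monotonicity along rays. -/

/-- Let `T` be smooth with `T (a, 0) = 0` and `‖z‖ ≤ L * ‖T (a, z)‖` near `(a₀, 0)`. Then, near
`(a₀, 0)`, the function `‖T (a, z)‖` is nondecreasing along the rays `z ∈ ℝ₊ v`. -/
theorem exists_norm_le_norm_of_ray {A B : Type*} [NormedAddCommGroup A] [NormedSpace ℝ A]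
    [NormedAddCommGroup B] [InnerProductSpace ℝ B] {T : A × B → B} {O : Set (A × B)}
    (hO : IsOpen O) (hT : ContDiffOn ℝ ∞ T O) {a₀ : A} (ha₀ : (a₀, (0 : B)) ∈ O)
    (h0 : ∀ a, (a, (0 : B)) ∈ O → T (a, 0) = 0) {C : ℝ}
    (hC : ∀ᶠ p in 𝓝 (a₀, (0 : B)), ‖p.2‖ ≤ C * ‖T p‖) :
    ∃ ε > 0, Metric.ball a₀ ε ×ˢ Metric.ball (0 : B) ε ⊆ O ∧
      ∀ a ∈ Metric.ball a₀ ε, ∀ z ∈ Metric.ball (0 : B) ε, ∀ l ∈ Set.Icc (0 : ℝ) 1,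
        ‖T (a, l • z)‖ ≤ ‖T (a, z)‖ := by
  obtain ⟨C, hC1, hC⟩ : ∃ C > 0, ∀ᶠ p in 𝓝 (a₀, (0 : B)), ‖p.2‖ ≤ C * ‖T p‖ := by
    refine ⟨max C 1, by positivity, hC.mono fun p hp => hp.trans ?_⟩
    gcongr; exact le_max_left _ _
  have hTa : ContDiffAt ℝ ∞ T (a₀, 0) := hT.contDiffAt (hO.mem_nhds ha₀)
  have hstrict : HasStrictFDerivAt T (fderiv ℝ T (a₀, 0)) (a₀, 0) :=
    hTa.hasStrictFDerivAt (by simp)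
  have hcont : ContinuousAt (fderiv ℝ T) (a₀, 0) :=
    (hT.continuousOn_fderiv_of_isOpen hO (by simp)).continuousAt (hO.mem_nhds ha₀)
  -- This tolerance serves twice, for the linearization error and for the variation of the
  -- derivative; together they are at most `‖p.2‖ / C ≤ ‖T p‖`.
  have hδ : (0 : ℝ) < 1 / (2 * C) := by positivity
  have e1 := hstrict.isLittleO.def hδ
  have e1' : ∀ᶠ p in 𝓝 (a₀, (0 : B)), ‖T p - T (p.1, 0) - fderiv ℝ T (a₀, 0) (0, p.2)‖
      ≤ 1 / (2 * C) * ‖p.2‖ := by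
    have ht : Filter.Tendsto (fun p : A × B => (p, (p.1, (0 : B)))) (𝓝 (a₀, 0))
        (𝓝 ((a₀, 0), (a₀, 0))) := by
      have : Continuous (fun p : A × B => (p, (p.1, (0 : B)))) := by fun_prop
      exact this.tendsto' _ _ rfl
    filter_upwards [ht.eventually e1] with p hp
    have : p - (p.1, 0) = (0, p.2) := by ext <;> simp
    simpa [this, Prod.norm_def] using hp
  have e2 : ∀ᶠ p in 𝓝 (a₀, (0 : B)), ‖fderiv ℝ T p - fderiv ℝ T (a₀, 0)‖ < 1 / (2 * C) := by
    have ht : Filter.Tendsto (fun p => ‖fderiv ℝ T p - fderiv ℝ T (a₀, 0)‖) (𝓝 (a₀, 0)) (𝓝 0) := by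
      exact (tendsto_iff_norm_sub_tendsto_zero (E := A × B →L[ℝ] B)).1 hcont
    exact ht.eventually_lt_const hδ
  have e3 : ∀ᶠ p in 𝓝 (a₀, (0 : B)), p ∈ O := hO.mem_nhds ha₀
  obtain ⟨ε, hε, hball⟩ := Metric.eventually_nhds_iff_ball.1
    ((e3.and e1').and (e2.and hC))
  rw [← ball_prod_same] at hball
  refine ⟨ε, hε, fun p hp => (hball p hp).1.1, fun a ha z hz => ?_⟩
  have hmem : ∀ l ∈ Set.Icc (0 : ℝ) 1, (a, l • z) ∈ Metric.ball a₀ ε ×ˢ Metric.ball (0 : B) ε := by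
    refine fun l hl => ⟨ha, ?_⟩
    simp only [mem_ball_zero_iff, norm_smul, Real.norm_eq_abs, abs_of_nonneg hl.1] at hz ⊢
    exact (mul_le_of_le_one_left (norm_nonneg _) hl.2).trans_lt hz
  have hline : ∀ l : ℝ, HasDerivAt (fun l : ℝ => (a, l • z)) ((0 : A), z) l := fun l =>
    (hasDerivAt_const l a).prodMk (by simpa using (hasDerivAt_id l).smul_const z)
  have hder : ∀ l ∈ Set.Icc (0 : ℝ) 1,
      HasDerivAt (fun l : ℝ => T (a, l • z)) (fderiv ℝ T (a, l • z) (0, z)) l := fun l hl =>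
    ((hT.contDiffAt (hO.mem_nhds (hball _ (hmem l hl)).1.1)).differentiableAt
      (by simp)).hasFDerivAt.comp_hasDerivAt l (hline l)
  -- The derivative in `l` is `2⟪T, DT (0, z)⟫`. Since `DT (0, l • z)` is at distance at most `‖T‖`
  -- from `T`, Cauchy–Schwarz makes this nonnegative.
  have hmono : MonotoneOn (fun l : ℝ => ‖T (a, l • z)‖ ^ 2) (Set.Icc 0 1) := by
    refine monotoneOn_of_deriv_nonneg (convex_Icc 0 1)
      (fun l hl => (hder l hl).norm_sq.continuousAt.continuousWithinAt)
      (fun l hl => (hder l (interior_subset hl)).norm_sq.differentiableAt.differentiableWithinAt)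
      fun l hl => ?_
    have hl0 : 0 < l := by
      rw [interior_Icc] at hl; exact hl.1
    have hl' := interior_subset hl
    rw [(hder l hl').norm_sq.deriv]
    obtain ⟨⟨hpO, h1⟩, h2, h3⟩ := hball _ (hmem l hl')
    set p : A × B := (a, l • z) with hp
    have hpa : T (p.1, 0) = 0 := by
      refine h0 _ (hball (p.1, 0) ⟨ha, ?_⟩).1.1
      simpa using hε
    rw [hpa, sub_zero] at h1
    have h4 : ‖fderiv ℝ T p (0, l • z) - fderiv ℝ T (a₀, 0) (0, l • z)‖ ≤
        1 / (2 * C) * ‖l • z‖ := by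
      rw [← sub_apply]
      refine (ContinuousLinearMap.le_opNorm _ _).trans ?_
      have : ‖((0 : A), l • z)‖ = ‖l • z‖ := by simp [Prod.norm_def]
      rw [this]
      gcongr
    have h5 : ‖T p - fderiv ℝ T p (0, l • z)‖ ≤ ‖T p‖ := by
      have : T p - fderiv ℝ T p (0, l • z) = (T p - fderiv ℝ T (a₀, 0) (0, l • z)) -
        (fderiv ℝ T p (0, l • z) - fderiv ℝ T (a₀, 0) (0, l • z)) := by abel
      rw [this]
      calc _ ≤ 1 / (2 * C) * ‖l • z‖ + 1 / (2 * C) * ‖l • z‖ := (norm_sub_le _ _).trans (add_le_add h1 h4)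
        _ = (1 / C) * ‖l • z‖ := by ring
        _ ≤ (1 / C) * (C * ‖T p‖) := by gcongr
        _ = ‖T p‖ := by field_simp
    have h6 : fderiv ℝ T p (0, l • z) = l • fderiv ℝ T p (0, z) := by
      rw [← map_smul]; simp
    have h7 : 0 ≤ inner ℝ (T p) (fderiv ℝ T p (0, l • z)) := by
      have := real_inner_le_norm (T p) (T p - fderiv ℝ T p (0, l • z))
      rw [inner_sub_right, real_inner_self_eq_norm_sq] at this
      nlinarith [norm_nonneg (T p)]
    rw [h6, inner_smul_right] at h7
    have := nonneg_of_mul_nonneg_right h7 hl0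
    linarith
  intro l hl
  have := hmono hl (Set.right_mem_Icc.2 zero_le_one) hl.2
  simp only [one_smul] at this
  exact (sq_le_sq₀ (norm_nonneg _) (norm_nonneg _)).1 this

/-! ### Star-shaped open sets are diffeomorphic to the vector space. -/

section StarShaped

variable {E : Type*} [NormedAddCommGroup E] [NormedSpace ℝ E] {Ω : Set E} {ρ : E → ℝ}

/-- The mean value of `ρ` on the segment from `0` to `x`. -/
noncomputable def segmentMean (ρ : E → ℝ) (x : E) : ℝ := ∫ t in (0 : ℝ)..1, ρ (t • x)

/-- Hence `x ↦ segmentMean ρ x • x` acts on each ray as a primitive of `ρ`. -/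
theorem mul_segmentMean_smul (ρ : E → ℝ) (x : E) (l : ℝ) :
    l * segmentMean ρ (l • x) = ∫ t in (0 : ℝ)..l, ρ (t • x) := by
  have := intervalIntegral.mul_integral_comp_mul_right (a := 0) (b := 1)
    (f := fun t => ρ (t • x)) (c := l)
  simpa [segmentMean, mul_smul] using this

/-- The substitution `t = smoothTransition u` gives an integral over `ℝ` of a function with compact
support in `u`, for which smooth dependence on `x` follows from the theory of convolutions. -/
theorem segmentMean_eq_integral_smoothTransition (hρ : ContinuousOn ρ Ω)
    (hstar : ∀ x ∈ Ω, ∀ l ∈ Set.Icc (0 : ℝ) 1, l • x ∈ Ω) {x : E} (hx : x ∈ Ω) :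
    segmentMean ρ x = ∫ u, ρ (Real.smoothTransition u • x) * deriv Real.smoothTransition u := by
  have hd : Differentiable ℝ Real.smoothTransition :=
    Real.smoothTransition.contDiff.differentiable one_ne_zero
  -- The bounds `-1` and `2` leave room around `[0, 1]`: `smoothTransition` is constant near each
  -- point outside `(-1, 2]`.
  have h1 := intervalIntegral.integral_comp_mul_deriv' (a := -1) (b := 2)
    (f := Real.smoothTransition) (f' := deriv Real.smoothTransition) (g := fun t => ρ (t • x))
    (fun u _ => (hd u).hasDerivAt)
    (Real.smoothTransition.contDiff (n := 1)).continuous_deriv_one.continuousOn (by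
      refine hρ.comp (by fun_prop) ?_
      rintro _ ⟨u, -, rfl⟩
      exact hstar x hx _ ⟨Real.smoothTransition.nonneg u, Real.smoothTransition.le_one u⟩)
  rw [Real.smoothTransition.zero_of_nonpos (by norm_num),
    Real.smoothTransition.one_of_one_le (by norm_num)] at h1
  rw [segmentMean, ← h1]
  refine intervalIntegral.integral_eq_integral_of_support_subset fun u hu => ?_
  by_contra hcon
  refine hu ?_
  have : deriv Real.smoothTransition u = 0 := by
    rw [Set.mem_Ioc, not_and_or, not_lt, not_le] at hcon
    rcases hcon with h | h
    · have : Real.smoothTransition =ᶠ[𝓝 u] fun _ => 0 := by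
        filter_upwards [gt_mem_nhds (show u < 0 by linarith)] with w hw
        exact Real.smoothTransition.zero_of_nonpos hw.le
      rw [this.deriv_eq, deriv_const]
    · have : Real.smoothTransition =ᶠ[𝓝 u] fun _ => 1 := by
        filter_upwards [lt_mem_nhds (show 1 < u by linarith)] with w hw
        exact Real.smoothTransition.one_of_one_le hw.le
      rw [this.deriv_eq, deriv_const]
  simp [this]

/-- The mean is the value at `0` of the convolution of the constant `1` with `g x`, whence the signs
`-u` in `g`. -/
theorem contDiffOn_segmentMean (hΩ : IsOpen Ω) (hρ : ContDiffOn ℝ ∞ ρ Ω)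
    (hstar : ∀ x ∈ Ω, ∀ l ∈ Set.Icc (0 : ℝ) 1, l • x ∈ Ω) :
    ContDiffOn ℝ ∞ (segmentMean ρ) Ω := by
  let g : E → ℝ → ℝ := fun x u =>
    ρ (Real.smoothTransition (-u) • x) * deriv Real.smoothTransition (-u)
  have hst : ContDiff ℝ ∞ Real.smoothTransition := Real.smoothTransition.contDiff
  have hst' : ContDiff ℝ ∞ (deriv Real.smoothTransition) := by
    exact (contDiff_infty_iff_deriv.1 hst).2
  have hg : ContDiffOn ℝ ∞ ↿g (Ω ×ˢ Set.univ) := by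
    refine ContDiffOn.mul (hρ.comp (f := fun p : E × ℝ => Real.smoothTransition (-p.2) • p.1)
      ?_ ?_) ?_
    · exact ((hst.comp contDiff_snd.neg).smul contDiff_fst).contDiffOn
    · rintro ⟨x, u⟩ hx
      exact hstar x hx.1 _ ⟨Real.smoothTransition.nonneg _, Real.smoothTransition.le_one _⟩
    · exact (hst'.comp contDiff_snd.neg).contDiffOn
  have := MeasureTheory.contDiffOn_convolution_right_with_param_comp (μ := MeasureTheory.volume)
    (ContinuousLinearMap.mul ℝ ℝ) (s := Ω) (v := fun _ => (0 : ℝ)) contDiffOn_const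
    (f := fun _ : ℝ => (1 : ℝ)) (g := g) (k := Set.Icc (-1) 0) hΩ isCompact_Icc ?_
    (MeasureTheory.locallyIntegrable_const _) hg
  · refine this.congr fun x hx => ?_
    rw [segmentMean_eq_integral_smoothTransition hρ.continuousOn hstar hx]
    simp [MeasureTheory.convolution, g]
  · intro x u _ hu
    have : deriv Real.smoothTransition (-u) = 0 := by
      rw [Set.mem_Icc, not_and_or, not_le, not_le] at hu
      rcases hu with h | h
      · have : Real.smoothTransition =ᶠ[𝓝 (-u)] fun _ => 1 := by
          filter_upwards [lt_mem_nhds (show 1 < -u by linarith)] with w hw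
          exact Real.smoothTransition.one_of_one_le hw.le
        rw [this.deriv_eq, deriv_const]
      · have : Real.smoothTransition =ᶠ[𝓝 (-u)] fun _ => 0 := by
          filter_upwards [gt_mem_nhds (show -u < 0 by linarith)] with w hw
          exact Real.smoothTransition.zero_of_nonpos hw.le
        rw [this.deriv_eq, deriv_const]
    simp [g, this]

/-- The radial derivative of `x ↦ segmentMean ρ x • x` is `ρ`. -/
theorem segmentMean_add_fderiv (hΩ : IsOpen Ω) (hρ : ContDiffOn ℝ ∞ ρ Ω)
    (hstar : ∀ x ∈ Ω, ∀ l ∈ Set.Icc (0 : ℝ) 1, l • x ∈ Ω) {x : E} (hx : x ∈ Ω) :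
    segmentMean ρ x + fderiv ℝ (segmentMean ρ) x x = ρ x := by
  have hc : Continuous fun t : ℝ => t • x := by fun_prop
  have hm : ContinuousOn (fun t : ℝ => ρ (t • x)) ((fun t : ℝ => t • x) ⁻¹' Ω) :=
    hρ.continuousOn.comp hc.continuousOn fun _ h => h
  have hopen := hΩ.preimage hc
  have h1 : (1 : ℝ) ∈ (fun t : ℝ => t • x) ⁻¹' Ω := by simpa using hx
  have hP : HasDerivAt (fun l => ∫ t in (0 : ℝ)..l, ρ (t • x)) (ρ ((1 : ℝ) • x)) 1 := by
    refine intervalIntegral.integral_hasDerivAt_right ?_ ?_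
      (hm.continuousAt (hopen.mem_nhds h1))
    · refine ContinuousOn.intervalIntegrable (hm.mono ?_)
      rw [Set.uIcc_of_le zero_le_one]
      exact fun l hl => hstar x hx l hl
    · exact hm.stronglyMeasurableAtFilter hopen _ h1
  have hD : HasFDerivAt (segmentMean ρ) (fderiv ℝ (segmentMean ρ) x) ((1 : ℝ) • x) := by
    rw [one_smul]
    exact (((contDiffOn_segmentMean hΩ hρ hstar).contDiffAt (hΩ.mem_nhds hx)).differentiableAt
      (by simp)).hasFDerivAt
  have hline : HasDerivAt (fun l : ℝ => l • x) x 1 := by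
    simpa using (hasDerivAt_id (1 : ℝ)).smul_const x
  have h2 := (hasDerivAt_id (1 : ℝ)).mul (hD.comp_hasDerivAt 1 hline)
  have h3 : (fun l => ∫ t in (0 : ℝ)..l, ρ (t • x)) = fun l => id l * (segmentMean ρ ∘ fun l : ℝ => l • x) l :=
    funext fun l => (mul_segmentMean_smul ρ x l).symm
  rw [h3] at hP
  have := h2.unique hP
  simpa using this

/-- A bounded open set of `ℝⁿ` that is star-shaped with respect to the origin is diffeomorphic to
`ℝⁿ`. -/
theorem exists_bijOn_univ_of_starShaped [FiniteDimensional ℝ E] (hΩ : IsOpen Ω)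
    (hbdd : Bornology.IsBounded Ω) (h0 : (0 : E) ∈ Ω)
    (hstar : ∀ x ∈ Ω, ∀ l ∈ Set.Icc (0 : ℝ) 1, l • x ∈ Ω) :
    ∃ θ : E → E, θ 0 = 0 ∧ (∀ x ∈ Ω, IsLocalDiffeomorphAt 𝓘(ℝ, E) 𝓘(ℝ, E) ∞ θ x) ∧
      Set.BijOn θ Ω Set.univ := by
  obtain ⟨φ, hsupp, hφ, hrange⟩ := hΩ.exists_contDiff_support_eq (n := ⊤)
  have hφ01 : ∀ x, 0 ≤ φ x ∧ φ x ≤ 1 := fun x => hrange ⟨x, rfl⟩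
  have hφpos : ∀ x ∈ Ω, 0 < φ x := fun x hx =>
    lt_of_le_of_ne (hφ01 x).1 fun h => by rw [← hsupp] at hx; exact hx h.symm
  -- Along a ray, `φ` vanishes to first order at least where the ray leaves `Ω`, so `ρ` grows there
  -- at least like the inverse square of the distance and its integral diverges. The bound `φ ≤ 1`
  -- gives `ρ ≥ 1`.
  let ρ : E → ℝ := fun x => (φ x ^ 2)⁻¹
  have hρ : ContDiffOn ℝ ∞ ρ Ω := (hφ.pow 2).contDiffOn.inv fun x hx => (pow_pos (hφpos x hx) 2).ne'
  have hρ1 : ∀ x ∈ Ω, 1 ≤ ρ x := fun x hx =>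
    (one_le_inv₀ (pow_pos (hφpos x hx) 2)).2 (pow_le_one₀ (hφ01 x).1 (hφ01 x).2)
  have hint : ∀ (v : E) (a b : ℝ), 0 ≤ a → a ≤ b → b • v ∈ Ω →
      IntervalIntegrable (fun t => ρ (t • v)) MeasureTheory.volume a b := by
    intro v a b ha hab hb
    refine ContinuousOn.intervalIntegrable (hρ.continuousOn.comp (by fun_prop) ?_)
    rw [Set.uIcc_of_le hab]
    intro t ht
    rcases (ha.trans hab).eq_or_lt with hb0 | hb0
    · have : t = 0 := le_antisymm (ht.2.trans hb0.ge) (ha.trans ht.1)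
      simpa [this] using h0
    · have := hstar _ hb (t / b) ⟨by have := ha.trans ht.1; positivity, (div_le_one hb0).2 ht.2⟩
      rwa [smul_smul, div_mul_cancel₀ _ hb0.ne'] at this
  have hseg : ∀ (v : E) (a b : ℝ), 0 ≤ a → a ≤ b → b • v ∈ Ω → ∀ t ∈ Set.Icc a b, t • v ∈ Ω := by
    intro v a b ha hab hb t ht
    rcases (ha.trans hab).eq_or_lt with hb0 | hb0
    · have : t = 0 := le_antisymm (ht.2.trans hb0.ge) (ha.trans ht.1)
      simpa [this] using h0
    · have := hstar _ hb (t / b) ⟨by have := ha.trans ht.1; positivity, (div_le_one hb0).2 ht.2⟩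
      rwa [smul_smul, div_mul_cancel₀ _ hb0.ne'] at this
  have hincr : ∀ (v : E) (a b : ℝ), 0 ≤ a → a ≤ b → b • v ∈ Ω →
      (b - a) + ∫ t in (0 : ℝ)..a, ρ (t • v) ≤ ∫ t in (0 : ℝ)..b, ρ (t • v) := by
    intro v a b ha hab hb
    have hav := hseg v a b ha hab hb a ⟨le_rfl, hab⟩
    rw [← intervalIntegral.integral_add_adjacent_intervals (hint v 0 a le_rfl ha hav)
      (hint v a b ha hab hb), add_comm]
    gcongr
    have := intervalIntegral.integral_mono_on hab (intervalIntegrable_const (c := (1 : ℝ)))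
      (hint v a b ha hab hb) fun t ht => hρ1 _ (hseg v a b ha hab hb t ht)
    simpa using this
  have hpos : ∀ x ∈ Ω, 0 < segmentMean ρ x := by
    intro x hx
    have := hincr x 0 1 le_rfl zero_le_one (by simpa using hx)
    simp only [sub_zero, intervalIntegral.integral_same, add_zero] at this
    exact zero_lt_one.trans_le this
  have hsm := contDiffOn_segmentMean hΩ hρ hstar
  refine ⟨fun x => segmentMean ρ x • x, by simp, fun x hx => ?_, fun _ _ => trivial, ?_, ?_⟩
  · have hd : DifferentiableAt ℝ (segmentMean ρ) x :=
      (hsm.contDiffAt (hΩ.mem_nhds hx)).differentiableAt (by simp)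
    have hder := hd.hasFDerivAt.smul (hasFDerivAt_id x)
    set D := segmentMean ρ x • ContinuousLinearMap.id ℝ E +
      (fderiv ℝ (segmentMean ρ) x).smulRight (id x) with hDdef
    have hDinj : Function.Injective D := by
      rw [injective_iff_map_eq_zero]
      intro v hv
      have hv' : segmentMean ρ x • v + fderiv ℝ (segmentMean ρ) x v • x = 0 := by
        simpa [hDdef] using hv
      have hrad := segmentMean_add_fderiv hΩ hρ hstar hx
      have hx0 := hpos x hx
      -- `D v` is a nonzero multiple of `v` plus a multiple of `x`, so a kernel vector is radial; on
      -- radial vectors `D` is multiplication by `ρ x`.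
      obtain ⟨μ, rfl⟩ : ∃ μ : ℝ, v = μ • x := by
        refine ⟨-((segmentMean ρ x)⁻¹ * fderiv ℝ (segmentMean ρ) x v), ?_⟩
        rw [neg_smul, mul_smul, eq_neg_of_add_eq_zero_right hv', smul_neg, smul_smul,
          inv_mul_cancel₀ hx0.ne', one_smul, neg_neg]
      have : (μ * ρ x) • x = 0 := by
        rw [← hrad, ← hv', map_smul, smul_smul, ← add_smul]
        congr 1
        simp only [smul_eq_mul]; ring
      rcases smul_eq_zero.1 this with h | h
      · rcases mul_eq_zero.1 h with h | h
        · rw [h, zero_smul]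
        · linarith [hρ1 x hx]
      · rw [h, smul_zero]
    let D' := (LinearEquiv.ofInjectiveEndo (D : E →ₗ[ℝ] E) hDinj).toContinuousLinearEquiv
    refine ContDiffOn.isLocalDiffeomorphAt hΩ (hsm.smul contDiffOn_id) hx D' ?_
    have : (D' : E →L[ℝ] E) = D := by ext v; rfl
    rw [this]; exact hder
  -- Two points with the same image lie on one ray, and there the primitive of `ρ` grows with slope
  -- at least `1`.
  · have key : ∀ x ∈ Ω, ∀ l : ℝ, 0 < l → l ≤ 1 →
        segmentMean ρ x = l * segmentMean ρ (l • x) → l = 1 := by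
      intro x hx l hl hl1 h
      rw [mul_segmentMean_smul] at h
      have := hincr x l 1 hl.le hl1 (by simpa using hx)
      rw [← h] at this
      change _ + segmentMean ρ x ≤ segmentMean ρ x at this
      linarith
    intro x hx y hy hxy
    change segmentMean ρ x • x = segmentMean ρ y • y at hxy
    have hx0 := hpos x hx
    have hy0 := hpos y hy
    rcases le_total (segmentMean ρ x / segmentMean ρ y) 1 with hle | hle
    · have hyx : y = (segmentMean ρ x / segmentMean ρ y) • x := by
        rw [div_eq_inv_mul, mul_smul, hxy, smul_smul, inv_mul_cancel₀ hy0.ne', one_smul]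
      have := key x hx _ (by positivity) hle (by rw [← hyx]; field_simp)
      rw [this, one_smul] at hyx
      exact hyx.symm
    · have hyx : x = (segmentMean ρ y / segmentMean ρ x) • y := by
        rw [div_eq_inv_mul, mul_smul, ← hxy, smul_smul, inv_mul_cancel₀ hx0.ne', one_smul]
      have := key y hy (segmentMean ρ y / segmentMean ρ x) (by positivity) (by rw [one_le_div hy0] at hle; exact (div_le_one hx0).2 hle)
        (by rw [← hyx]; field_simp)
      rw [this, one_smul] at hyx
      exact hyx
  · intro v _
    by_cases hv : v = 0
    · exact ⟨0, h0, by simp [hv]⟩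
    suffices ∃ l : ℝ, 0 ≤ l ∧ l • v ∈ Ω ∧ ∫ t in (0 : ℝ)..l, ρ (t • v) = 1 by
      obtain ⟨l, -, hl, h⟩ := this
      refine ⟨l • v, hl, ?_⟩
      change segmentMean ρ (l • v) • l • v = v
      rw [smul_smul, mul_comm, mul_segmentMean_smul, h, one_smul]
    suffices ∃ l : ℝ, 0 ≤ l ∧ l • v ∈ Ω ∧ 1 ≤ ∫ t in (0 : ℝ)..l, ρ (t • v) by
      obtain ⟨l, hl0, hl, h⟩ := this
      have hcont : ContinuousOn (fun l => ∫ t in (0 : ℝ)..l, ρ (t • v)) (Set.Icc 0 l) := by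
        have hI := (intervalIntegrable_iff_integrableOn_Icc_of_le hl0).1 (hint v 0 l le_rfl hl0 hl)
        rw [← Set.uIcc_of_le hl0] at hI ⊢
        exact intervalIntegral.continuousOn_primitive_interval hI
      obtain ⟨l', hl', h'⟩ := intermediate_value_Icc hl0 hcont (show (1 : ℝ) ∈ _ from ⟨by simp, h⟩)
      exact ⟨l', hl'.1, hseg v 0 l le_rfl hl0 hl l' hl', h'⟩
    let A : Set ℝ := {l | 0 ≤ l ∧ l • v ∈ Ω}
    have hA0 : (0 : ℝ) ∈ A := ⟨le_rfl, by simpa using h0⟩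
    have hAb : BddAbove A := by
      obtain ⟨R, hR⟩ := hbdd.exists_norm_le
      refine ⟨R / ‖v‖, fun l hl => ?_⟩
      have := hR _ hl.2
      rw [norm_smul, Real.norm_eq_abs, abs_of_nonneg hl.1] at this
      exact (le_div_iff₀ (norm_pos_iff.2 hv)).2 this
    set b := sSup A with hb
    have hlt : ∀ l, 0 ≤ l → l < b → l • v ∈ Ω := by
      intro l hl hlb
      obtain ⟨l', hl', hll'⟩ := exists_lt_of_lt_csSup ⟨0, hA0⟩ hlb
      exact hseg v 0 l' le_rfl hl'.1 hl'.2 l ⟨hl, hll'.le⟩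
    have hc : Continuous fun t : ℝ => t • v := by fun_prop
    have hbΩ : b • v ∉ Ω := by
      intro hmem
      obtain ⟨ε, hε, hball⟩ := Metric.isOpen_iff.1 (hΩ.preimage hc) b hmem
      have : b + ε / 2 ∈ A := by
        refine ⟨by have := le_csSup hAb hA0; positivity, hball ?_⟩
        simp only [Metric.mem_ball, Real.dist_eq, add_sub_cancel_left]
        rw [abs_of_pos (by positivity)]; linarith
      have := le_csSup hAb this
      linarith
    have hb0 : 0 < b := by
      refine lt_of_le_of_ne (le_csSup hAb hA0) fun h => hbΩ ?_
      rw [← h]; simpa using h0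
    have hφb : φ (b • v) = 0 := by
      by_contra h
      exact hbΩ (hsupp ▸ h)
    have hdiff : DifferentiableAt ℝ (fun t : ℝ => φ (t • v)) b :=
      ((hφ.differentiable (by simp)).comp (differentiable_id.smul_const v)) b
    obtain ⟨C, hC, hCb⟩ := hdiff.isBigO_sub.exists_pos
    rw [Asymptotics.IsBigOWith] at hCb
    obtain ⟨ε, hε, hball⟩ := Metric.eventually_nhds_iff_ball.1 hCb
    -- On `[b - 2u, b - u]`, which lies in `[0, b)` and in the ball where `φ (t • v) ≤ C (b - t)`,
    -- one has `ρ ≥ 1 / (4C²u²)`; the integral over it is then at least `1 / (4C²u) ≥ 1`.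
    let u := min (ε / 4) (min (b / 2) (1 / (4 * C ^ 2)))
    have hu : 0 < u := by positivity
    have hu1 : u ≤ ε / 4 := min_le_left _ _
    have hu2 : u ≤ b / 2 := (min_le_right _ _).trans (min_le_left _ _)
    have hu3 : u ≤ 1 / (4 * C ^ 2) := (min_le_right _ _).trans (min_le_right _ _)
    have hbu : (b - u) • v ∈ Ω := hlt _ (by linarith) (by linarith)
    refine ⟨b - u, by linarith, hbu, ?_⟩
    have hbu2 : 0 ≤ b - 2 * u := by linarith
    rw [← intervalIntegral.integral_add_adjacent_intervals
      (hint v 0 (b - 2 * u) le_rfl hbu2 (hlt _ hbu2 (by linarith)))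
      (hint v (b - 2 * u) (b - u) hbu2 (by linarith) hbu)]
    have hI1 : 0 ≤ ∫ t in (0 : ℝ)..(b - 2 * u), ρ (t • v) := by
      have := hincr v 0 (b - 2 * u) le_rfl hbu2 (hlt _ hbu2 (by linarith))
      simp only [intervalIntegral.integral_same] at this
      linarith
    have hI2 : 1 ≤ ∫ t in (b - 2 * u)..(b - u), ρ (t • v) := by
      have hle : b - 2 * u ≤ b - u := by linarith
      have := intervalIntegral.integral_mono_on hle
        (intervalIntegrable_const (c := 1 / (4 * C ^ 2 * u ^ 2)))
        (hint v (b - 2 * u) (b - u) hbu2 hle hbu) fun t ht => ?_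
      · refine le_trans ?_ this
        rw [intervalIntegral.integral_const, smul_eq_mul, show b - u - (b - 2 * u) = u by ring]
        rw [le_div_iff₀ (by positivity)] at hu3
        rw [mul_one_div, le_div_iff₀ (by positivity)]
        nlinarith
      · have htΩ := hseg v (b - 2 * u) (b - u) hbu2 hle hbu t ht
        have h1 := hball t (by
          rw [Metric.mem_ball, Real.dist_eq, abs_lt]; constructor <;> linarith [ht.1, ht.2])
        rw [hφb, sub_zero, Real.norm_eq_abs, Real.norm_eq_abs, abs_of_pos (hφpos _ htΩ),
          abs_sub_comm, abs_of_nonneg (by linarith [ht.2])] at h1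
        have h2 : φ (t • v) ≤ 2 * C * u := by nlinarith [ht.1]
        rw [one_div]
        refine inv_anti₀ (pow_pos (hφpos _ htΩ) 2) ?_
        have := pow_le_pow_left₀ (hφpos _ htΩ).le h2 2
        linarith [this]
    linarith

end StarShaped

/-! ### Smooth retractions to a compact Lie group. -/

section Retraction

variable {A E : Type*} [NormedAddCommGroup A] [NormedSpace ℝ A] [NormedAddCommGroup E]
  [NormedSpace ℝ E] [FiniteDimensional ℝ E]
  {K : Type*} [TopologicalSpace K] [ChartedSpace A K] [Group K] [LieGroup 𝓘(ℝ, A) ∞ K]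
  {G : Type*} [TopologicalSpace G] [ChartedSpace E G] [IsManifold 𝓘(ℝ, E) ∞ G]
  [T2Space G] [NormalSpace G] [SigmaCompactSpace G]

variable (A E) in
/-- A smooth retraction, along `ι : K → G`, of the open set `V ⊆ G` to its part in `K`. -/
structure IsRetractionOn (ι : K → G) (r : G → K) (V : Set G) : Prop where
  isOpen : IsOpen V
  contMDiffOn : ContMDiffOn 𝓘(ℝ, E) 𝓘(ℝ, A) ∞ r V
  apply_eq : ∀ h, ι h ∈ V → r (ι h) = h

/-- Smooth retractions near two compact subsets of a Lie group can be glued. -/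
theorem IsRetractionOn.exists_union {ι : K → G} (hι : Continuous ι) {r₀ r₁ : G → K}
    {V₀ V₁ : Set G} (h₀ : IsRetractionOn A E ι r₀ V₀) (h₁ : IsRetractionOn A E ι r₁ V₁)
    {C₀ C₁ : Set K} (hC₀ : IsCompact C₀) (hC₁ : IsCompact C₁) (hV₀ : Set.MapsTo ι C₀ V₀)
    (hV₁ : Set.MapsTo ι C₁ V₁) :
    ∃ r V, IsRetractionOn A E ι r V ∧ Set.MapsTo ι (C₀ ∪ C₁) V := by
  classical
  -- Near `F₀` only `r₀` can be used and near `F₁` only `r₁`; the rest of `C₀ ∪ C₁` is mapped into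
  -- `V₀ ∩ V₁`, where both are available.
  let F₀ := ι '' (C₀ \ ι ⁻¹' V₁)
  let F₁ := ι '' (C₁ \ ι ⁻¹' V₀)
  have hF₀ : IsClosed F₀ := ((hC₀.diff (h₁.isOpen.preimage hι)).image hι).isClosed
  have hF₁ : IsClosed F₁ := ((hC₁.diff (h₀.isOpen.preimage hι)).image hι).isClosed
  have hdisj : Disjoint F₀ F₁ := by
    rw [Set.disjoint_left]
    rintro _ ⟨h, hh, rfl⟩ ⟨h', hh', he⟩
    exact hh'.2 (by change ι h' ∈ V₀; rw [he]; exact hV₀ hh.1)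
  obtain ⟨χ, hχ0, hχ1, hχ⟩ := exists_contMDiffMap_zero_one_nhds_of_isClosed (n := ⊤) 𝓘(ℝ, E)
    hF₀ hF₁ hdisj
  obtain ⟨Z₀, hZ₀, hFZ₀, hχZ₀⟩ := mem_nhdsSet_iff_exists.1 hχ0
  obtain ⟨Z₁, hZ₁, hFZ₁, hχZ₁⟩ := mem_nhdsSet_iff_exists.1 hχ1
  let c := chartAt A (1 : K)
  obtain ⟨ε, hε, hball⟩ := Metric.isOpen_iff.1 c.open_target (c 1) (mem_chart_target A (1 : K))
  let q : G → K := fun g => (r₀ g)⁻¹ * r₁ g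
  have hq : ContMDiffOn 𝓘(ℝ, E) 𝓘(ℝ, A) ∞ q (V₀ ∩ V₁) :=
    (h₀.contMDiffOn.mono Set.inter_subset_left).inv.mul
      (h₁.contMDiffOn.mono Set.inter_subset_right)
  let S : Set K := c.source ∩ c ⁻¹' Metric.ball (c 1) ε
  have hS : IsOpen S := c.isOpen_inter_preimage Metric.isOpen_ball
  have h1S : (1 : K) ∈ S := ⟨mem_chart_source A 1, Metric.mem_ball_self hε⟩
  let D : Set G := (V₀ ∩ V₁) ∩ q ⁻¹' S
  have hD : IsOpen D := hq.continuousOn.isOpen_inter_preimage (h₀.isOpen.inter h₁.isOpen) hS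
  -- The quotient `q = r₀⁻¹ r₁` is joined to `1` by a segment in the chart at `1`. Multiplying by
  -- `r₀` gives `r₀` where `χ = 0` and `r₁` where `χ = 1`; on `K` the quotient is `1`, so the result
  -- is still a retraction.
  let w : G → A := fun g => c 1 + χ g • (c (q g) - c 1)
  have hw : ContMDiffOn 𝓘(ℝ, E) 𝓘(ℝ, A) ∞ w D := by
    have hc : ContMDiffOn 𝓘(ℝ, E) 𝓘(ℝ, A) ∞ (fun g => c (q g)) D :=
      (contMDiffOn_chart (I := 𝓘(ℝ, A)) (n := ∞) (x := (1 : K))).comp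
        (hq.mono Set.inter_subset_left) fun g hg => hg.2.1
    exact contMDiffOn_const.add (χ.contMDiff.contMDiffOn.smul (hc.sub contMDiffOn_const))
  have hwball : ∀ g ∈ D, w g ∈ c.target := by
    intro g hg
    refine hball ?_
    have h2 : ‖c (q g) - c 1‖ < ε := by simpa [dist_eq_norm] using hg.2.2
    have h3 := hχ g
    rw [mem_ball_iff_norm]
    simp only [w, add_sub_cancel_left, norm_smul, Real.norm_eq_abs, abs_of_nonneg h3.1]
    exact (mul_le_of_le_one_left (norm_nonneg _) h3.2).trans_lt h2
  let p : G → K := fun g => r₀ g * c.symm (w g)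
  have hp : ContMDiffOn 𝓘(ℝ, E) 𝓘(ℝ, A) ∞ p D :=
    (h₀.contMDiffOn.mono fun g hg => hg.1.1).mul
      ((contMDiffOn_chart_symm (I := 𝓘(ℝ, A)) (n := ∞) (x := (1 : K))).comp hw hwball)
  let r : G → K := fun g => if g ∈ D then p g else if g ∈ Z₀ then r₀ g else r₁ g
  have hrD : Set.EqOn r p D := fun g hg => if_pos hg
  have hr₀ : Set.EqOn r r₀ (V₀ ∩ Z₀) := by
    intro g hg
    by_cases hgD : g ∈ D
    · rw [hrD hgD]
      have e : χ g = 0 := hχZ₀ hg.2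
      simp only [p, w, e, zero_smul, add_zero]
      rw [c.left_inv h1S.1, mul_one]
    · simp only [r, if_neg hgD, if_pos hg.2]
  have hr₁ : Set.EqOn r r₁ (V₁ ∩ Z₁) := by
    intro g hg
    by_cases hgD : g ∈ D
    · rw [hrD hgD]
      have e : χ g = 1 := hχZ₁ hg.2
      simp only [p, w, e, one_smul, add_sub_cancel]
      rw [c.left_inv hgD.2.1]
      simp [q]
    · have : g ∉ Z₀ := by
        intro h
        have h0 : χ g = 0 := hχZ₀ h
        have h1 : χ g = 1 := hχZ₁ hg.2
        exact one_ne_zero (h1.symm.trans h0)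
      simp only [r, if_neg hgD, if_neg this]
  refine ⟨r, D ∪ (V₀ ∩ Z₀ ∪ V₁ ∩ Z₁), ⟨hD.union ((h₀.isOpen.inter hZ₀).union (h₁.isOpen.inter hZ₁)),
    ?_, ?_⟩, ?_⟩
  · refine (hp.congr hrD).union_of_isOpen (ContMDiffOn.union_of_isOpen
      ((h₀.contMDiffOn.mono Set.inter_subset_left).congr hr₀)
      ((h₁.contMDiffOn.mono Set.inter_subset_left).congr hr₁) ?_ ?_) hD ?_
    exacts [h₀.isOpen.inter hZ₀, h₁.isOpen.inter hZ₁,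
      (h₀.isOpen.inter hZ₀).union (h₁.isOpen.inter hZ₁)]
  · rintro h (hh | hh | hh)
    · rw [hrD hh]
      have : q (ι h) = 1 := by simp [q, h₀.apply_eq h hh.1.1, h₁.apply_eq h hh.1.2]
      simp only [p, w, this, sub_self, smul_zero, add_zero]
      rw [c.left_inv h1S.1, mul_one, h₀.apply_eq h hh.1.1]
    · rw [hr₀ hh, h₀.apply_eq h hh.1]
    · rw [hr₁ hh, h₁.apply_eq h hh.1]
  · intro h hh
    by_cases hv₀ : ι h ∈ V₀
    · by_cases hv₁ : ι h ∈ V₁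
      · refine Or.inl ⟨⟨hv₀, hv₁⟩, ?_⟩
        have : q (ι h) = 1 := by simp [q, h₀.apply_eq h hv₀, h₁.apply_eq h hv₁]
        simpa [this] using h1S
      · refine Or.inr (Or.inl ⟨hv₀, hFZ₀ ⟨h, ⟨?_, hv₁⟩, rfl⟩⟩)
        exact hh.resolve_right fun h' => hv₁ (hV₁ h')
    · have hh' : h ∈ C₁ := hh.resolve_left fun h' => hv₀ (hV₀ h')
      exact Or.inr (Or.inr ⟨hV₁ hh', hFZ₁ ⟨h, ⟨hh', hv₀⟩, rfl⟩⟩)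

/-- A compact Lie group embedded in a manifold is a smooth retract of a neighbourhood, provided that
it is so locally. -/
theorem exists_isRetractionOn [CompactSpace K] [T2Space K] {ι : K → G} (hι : Continuous ι)
    (hloc : ∀ h, ∃ r V, IsRetractionOn A E ι r V ∧ ι h ∈ V) :
    ∃ r V, IsRetractionOn A E ι r V ∧ ∀ h, ι h ∈ V := by
  -- Closures keep the sets compact in the induction, as gluing requires.
  suffices ∃ r V, IsRetractionOn A E ι r V ∧ Set.MapsTo ι (closure Set.univ) V by
    simpa [Set.MapsTo] using this
  refine isCompact_univ.induction_on
    (p := fun C => ∃ r V, IsRetractionOn A E ι r V ∧ Set.MapsTo ι (closure C) V) ?_ ?_ ?_ ?_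
  · obtain ⟨r, V, h, -⟩ := hloc 1
    exact ⟨r, V, h, by simp [Set.MapsTo]⟩
  · rintro C C' hCC' ⟨r, V, h, hV⟩
    exact ⟨r, V, h, hV.mono_left (closure_mono hCC')⟩
  · rintro C C' ⟨r, V, h, hV⟩ ⟨r', V', h', hV'⟩
    rw [closure_union]
    exact h.exists_union hι h' isClosed_closure.isCompact isClosed_closure.isCompact hV hV'
  · intro h _
    obtain ⟨r, V, hr, hV⟩ := hloc h
    obtain ⟨t, ht, htc, htV⟩ := exists_mem_nhds_isClosed_subset
      ((hr.isOpen.preimage hι).mem_nhds hV)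
    refine ⟨t, mem_nhdsWithin_of_mem_nhds ht, r, V, hr, ?_⟩
    rw [htc.closure_eq]
    exact htV

end Retraction

/-! ### Adapted charts and the pair formed by a retraction and an equation. -/

section AdaptedCharts

variable {A B E : Type*} [NormedAddCommGroup A] [NormedSpace ℝ A] [NormedAddCommGroup B]
  [NormedSpace ℝ B] [NormedAddCommGroup E] [NormedSpace ℝ E]
  {K : Type*} [TopologicalSpace K] [ChartedSpace A K]
  {G : Type*} [TopologicalSpace G] [ChartedSpace E G]

/-- The chart `e` of `G` around `ι h` is adapted to the submanifold `ι : K → G`, the zero locus of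
`π : G → B`, and to the chart of `K` around `h`. -/
structure IsAdaptedChart (ι : K → G) (π : G → B) (h : K)
    (e : PartialDiffeomorph 𝓘(ℝ, E) 𝓘(ℝ, A × B) G (A × B) ∞) : Prop where
  mem_source : ι h ∈ e.source
  snd_eq : ∀ g ∈ e.source, (e g).2 = π g
  mem_range : ∀ g ∈ e.source, (e g).2 = 0 → g ∈ Set.range ι
  mem_source_chartAt : ∀ h', ι h' ∈ e.source → h' ∈ (chartAt A h).source
  apply_eq : ∀ h', ι h' ∈ e.source → e (ι h') = (chartAt A h h', 0)

variable {ι : K → G} {π : G → B} {h : K}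
  {e : PartialDiffeomorph 𝓘(ℝ, E) 𝓘(ℝ, A × B) G (A × B) ∞}

/-- The first coordinate, read back through the chart of `K`, is a retraction. -/
theorem IsAdaptedChart.exists_isRetractionOn [IsManifold 𝓘(ℝ, A) ∞ K]
    (he : IsAdaptedChart ι π h e) : ∃ r V, IsRetractionOn A E ι r V ∧ ι h ∈ V := by
  have hfst : ContMDiffOn 𝓘(ℝ, E) 𝓘(ℝ, A) ∞ (fun g => (e g).1) e.source :=
    contDiff_fst.contMDiff.comp_contMDiffOn e.contMDiffOn_toFun
  refine ⟨fun g => (chartAt A h).symm (e g).1, e.source ∩ (fun g => (e g).1) ⁻¹' (chartAt A h).target,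
    ⟨hfst.continuousOn.isOpen_inter_preimage e.open_source (chartAt A h).open_target, ?_, ?_⟩,
    he.mem_source, ?_⟩
  · exact (contMDiffOn_chart_symm (I := 𝓘(ℝ, A)) (n := ∞) (x := h)).comp
      (hfst.mono Set.inter_subset_left) fun g hg => hg.2
  · intro h' hh'
    rw [he.apply_eq h' hh'.1]
    exact (chartAt A h).left_inv (he.mem_source_chartAt h' hh'.1)
  · change (e (ι h)).1 ∈ (chartAt A h).target
    rw [he.apply_eq h he.mem_source]
    exact mem_chart_target A h

/-- A smooth retraction `r` to the submanifold `K` and the equation `π` of `K` form together a local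
diffeomorphism along `K`. -/
theorem IsAdaptedChart.isLocalDiffeomorphAt [FiniteDimensional ℝ A] [FiniteDimensional ℝ B]
    [IsManifold 𝓘(ℝ, A) ∞ K] (he : IsAdaptedChart ι π h e) {r : G → K} {V : Set G}
    (hr : IsRetractionOn A E ι r V) (hV : ι h ∈ V) :
    IsLocalDiffeomorphAt 𝓘(ℝ, E) (𝓘(ℝ, A).prod 𝓘(ℝ, B)) ∞ (fun g => (r g, π g)) (ι h) := by
  let φ := chartAt A h
  let W : Set G := V ∩ r ⁻¹' φ.source
  have hW : IsOpen W := hr.contMDiffOn.continuousOn.isOpen_inter_preimage hr.isOpen φ.open_source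
  have hhW : ι h ∈ W := ⟨hV, by
    change r (ι h) ∈ φ.source
    rw [hr.apply_eq h hV]; exact mem_chart_source A h⟩
  let O : Set (A × B) := e.target ∩ e.symm ⁻¹' W
  have hO : IsOpen O := e.contMDiffOn_invFun.continuousOn.isOpen_inter_preimage e.open_target hW
  -- This is `(r, π)` in coordinates. It preserves the second coordinate and fixes the points of `A
  -- × 0`, so its derivative at `(a₀, 0)` is block unitriangular.
  let F : A × B → A × B := fun p => (φ (r (e.symm p)), p.2)
  have hF : ContDiffOn ℝ ∞ F O := by
    refine ContDiffOn.prodMk ?_ contDiffOn_snd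
    rw [← contMDiffOn_iff_contDiffOn]
    exact (contMDiffOn_chart (I := 𝓘(ℝ, A)) (n := ∞) (x := h)).comp
      (hr.contMDiffOn.comp (e.contMDiffOn_invFun.mono Set.inter_subset_left) fun p hp => hp.2.1)
      fun p hp => hp.2.2
  set a₀ := chartAt A h h
  have he0 : e (ι h) = (a₀, 0) := he.apply_eq h he.mem_source
  have hsymm : e.symm (a₀, 0) = ι h := by
    rw [← he0]; exact e.left_inv he.mem_source
  have ha₀ : (a₀, (0 : B)) ∈ O := by
    refine ⟨?_, ?_⟩
    · rw [← he0]; exact e.map_source he.mem_source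
    · change e.symm (a₀, 0) ∈ W
      rwa [hsymm]
  have hF0 : ∀ a, (a, (0 : B)) ∈ O → F (a, 0) = (a, 0) := by
    intro a ha
    have hs : e.symm (a, 0) ∈ e.source := e.map_target ha.1
    have hee : e (e.symm (a, 0)) = (a, 0) := e.right_inv ha.1
    obtain ⟨h', hh'⟩ := he.mem_range _ hs (by rw [hee])
    rw [← hh'] at hee hs
    rw [he.apply_eq h' hs] at hee
    have hV' : ι h' ∈ V := by
      rw [hh']; exact ha.2.1
    refine Prod.ext ?_ rfl
    change φ (r (e.symm (a, 0))) = a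
    rw [← hh', hr.apply_eq h' hV']
    exact congrArg Prod.fst hee
  have hFd : HasFDerivAt F (fderiv ℝ F (a₀, 0)) (a₀, 0) :=
    ((hF.contDiffAt (hO.mem_nhds ha₀)).differentiableAt (by simp)).hasFDerivAt
  set D := fderiv ℝ F (a₀, 0)
  have hD2 : ∀ v, (D v).2 = v.2 := by
    have h1 : HasFDerivAt (fun p => (F p).2) ((ContinuousLinearMap.snd ℝ A B).comp D) (a₀, 0) :=
      hFd.snd
    have h2 : HasFDerivAt (fun p : A × B => p.2) (ContinuousLinearMap.snd ℝ A B) (a₀, 0) :=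
      hasFDerivAt_snd
    exact fun v => congrArg (fun L : A × B →L[ℝ] B => L v) (h1.unique h2)
  have hD1 : ∀ u, D (u, 0) = (u, 0) := by
    have hinl : HasFDerivAt (fun a : A => (a, (0 : B))) (ContinuousLinearMap.inl ℝ A B) a₀ :=
      (ContinuousLinearMap.inl ℝ A B).hasFDerivAt
    have h1 : HasFDerivAt (fun a : A => F (a, 0)) (D.comp (ContinuousLinearMap.inl ℝ A B)) a₀ :=
      hFd.comp a₀ hinl
    have h2 : (fun a : A => F (a, 0)) =ᶠ[𝓝 a₀] fun a => (a, 0) := by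
      have : Continuous fun a : A => (a, (0 : B)) := by fun_prop
      filter_upwards [(hO.preimage this).mem_nhds ha₀] with a ha
      exact hF0 a ha
    have h3 := (hinl.congr_of_eventuallyEq h2).unique h1
    exact fun u => (congrArg (fun L : A →L[ℝ] A × B => L u) h3).symm
  have hDinj : Function.Injective D := by
    rw [injective_iff_map_eq_zero]
    rintro ⟨u, w⟩ hv
    have hw : w = 0 := by
      have := hD2 (u, w)
      rw [hv] at this
      exact this.symm
    subst hw
    rwa [hD1] at hv
  let D' := (LinearEquiv.ofInjectiveEndo (D : A × B →ₗ[ℝ] A × B) hDinj).toContinuousLinearEquiv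
  have hFloc : IsLocalDiffeomorphAt 𝓘(ℝ, A × B) 𝓘(ℝ, A × B) ∞ F (a₀, 0) := by
    refine hF.isLocalDiffeomorphAt hO ha₀ D' ?_
    have : (D' : A × B →L[ℝ] A × B) = D := by ext v <;> rfl
    rw [this]; exact hFd
  have h1 : IsLocalDiffeomorphAt 𝓘(ℝ, E) 𝓘(ℝ, A × B) ∞ e (ι h) :=
    e.isLocalDiffeomorphAt _ _ _ he.mem_source
  have h2 := h1.comp 𝓘(ℝ, A × B) _ (g := F) (by rw [he0]; exact hFloc)
  have h3 := h2.comp _ _ ((Diffeomorph.prodSelf A B).isLocalDiffeomorph _)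
  have h4 := h3.comp (𝓘(ℝ, A).prod 𝓘(ℝ, B)) (K × B) (g := Prod.map φ.symm id) (by
    refine isLocalDiffeomorphAt_prodMap (isLocalDiffeomorphAt_chartAt_symm ?_)
      (isLocalDiffeomorphAt_id _)
    change (F (e (ι h))).1 ∈ _
    rw [he0, hF0 _ ha₀]
    exact mem_chart_target A h)
  refine h4.congr_of_eventuallyEq ?_
  filter_upwards [(e.open_source.inter hW).mem_nhds ⟨he.mem_source, hhW⟩] with g hg
  have hg' : e.symm (e g) = g := e.left_inv hg.1
  refine Prod.ext ?_ (he.snd_eq g hg.1).symm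
  change r g = φ.symm (φ (r (e.symm (e g))))
  rw [hg']
  exact (φ.left_inv hg.2.2).symm

end AdaptedCharts

/-! ### The isotropy group as an embedded Lie group. -/

section Isotropy

variable {n m : ℕ}
    {M : Type*} [TopologicalSpace M]
    [ChartedSpace (EuclideanSpace ℝ (Fin n)) M]
    {G : Type*} [TopologicalSpace G]
    [ChartedSpace (EuclideanSpace ℝ (Fin m)) G]
    {𝒢 : LieGroupoid n m M G} {x : M}

theorem LieGroupoid.IsFixedPoint.target_eq (hfix : 𝒢.IsFixedPoint x) {g : G}
    (hg : 𝒢.source g = x) : 𝒢.target g = x := by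
  have : 𝒢.target g ∈ 𝒢.orbit x := ⟨g, hg, rfl⟩
  rwa [show 𝒢.orbit x = {x} from hfix] at this

theorem LieGroupoid.isEmbedding_isotropyIncl : Topology.IsEmbedding (𝒢.isotropyIncl x) :=
  Topology.IsEmbedding.subtypeVal

theorem LieGroupoid.mem_range_isotropyIncl (hfix : 𝒢.IsFixedPoint x) {g : G} :
    g ∈ Set.range (𝒢.isotropyIncl x) ↔ 𝒢.source g = x :=
  ⟨by rintro ⟨h, rfl⟩; exact h.2.1, fun h => ⟨⟨g, h, hfix.target_eq h⟩, rfl⟩⟩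

variable [IsManifold (𝓡 n) ∞ M] [IsManifold (𝓡 m) ∞ G]

theorem exists_partialDiffeomorph_apply_eq_zero (x : M) :
    ∃ c : PartialDiffeomorph (𝓡 n) (𝓡 n) M (EuclideanSpace ℝ (Fin n)) ∞,
      x ∈ c.source ∧ c x = 0 := by
  let b := chartAt (EuclideanSpace ℝ (Fin n)) x x
  have h1 := isLocalDiffeomorphAt_chartAt (mem_chart_source (EuclideanSpace ℝ (Fin n)) x)
  let τ : Diffeomorph (𝓡 n) (𝓡 n) (EuclideanSpace ℝ (Fin n)) (EuclideanSpace ℝ (Fin n)) ∞ :=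
    { toEquiv := Equiv.subRight b
      contMDiff_toFun := (contDiff_id.sub contDiff_const).contMDiff
      contMDiff_invFun := (contDiff_id.add contDiff_const).contMDiff }
  obtain ⟨c, hx, hc⟩ := h1.comp _ _ (τ.isLocalDiffeomorph _)
  refine ⟨c, hx, ?_⟩
  rw [← hc hx]
  exact sub_self b

/-- The isotropy group at a fixed point is an embedded Lie group. -/
theorem LieGroupoid.exists_lieGroup_isotropy (hfix : 𝒢.IsFixedPoint x)
    (c : PartialDiffeomorph (𝓡 n) (𝓡 n) M (EuclideanSpace ℝ (Fin n)) ∞) (hxc : x ∈ c.source)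
    (hcx : c x = 0) :
    ∃ (k : ℕ) (_ : ChartedSpace (EuclideanSpace ℝ (Fin k)) (𝒢.Isotropy x)),
      LieGroup (𝓡 k) ∞ (𝒢.Isotropy x) ∧
      Manifold.IsSmoothEmbedding (𝓡 k) (𝓡 m) ∞ (𝒢.isotropyIncl x) ∧
      ∀ h : 𝒢.Isotropy x,
        ∃ e : PartialDiffeomorph (𝓡 m)
            𝓘(ℝ, EuclideanSpace ℝ (Fin k) × EuclideanSpace ℝ (Fin n)) G
            (EuclideanSpace ℝ (Fin k) × EuclideanSpace ℝ (Fin n)) ∞,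
          IsAdaptedChart (𝒢.isotropyIncl x) (fun g => c (𝒢.source g)) h e ∧
          ∀ g ∈ e.source, 𝒢.source g ∈ c.source := by
  obtain ⟨F, _, _, hF⟩ := 𝒢.source_submersion
  -- The complement `F` in the normal form of the submersion is an abstract space; the isomorphism
  -- `ℝᵐ ≃ ℝⁿ × F` makes it finite-dimensional, so that it can be replaced by some `ℝᵏ`.
  have E₁ := (hF (𝒢.unit x)).equiv
  have : FiniteDimensional ℝ (EuclideanSpace ℝ (Fin n) × F) := E₁.toLinearEquiv.finiteDimensional
  have : FiniteDimensional ℝ F :=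
    Module.Finite.of_surjective (LinearMap.snd ℝ (EuclideanSpace ℝ (Fin n)) F)
      LinearMap.snd_surjective
  let k := Module.finrank ℝ F
  have E₂ : F ≃L[ℝ] EuclideanSpace ℝ (Fin k) :=
    ContinuousLinearEquiv.ofFinrankEq (by simp [k])
  have hs := hF.trans_F E₂
  let L : (EuclideanSpace ℝ (Fin k) × EuclideanSpace ℝ (Fin n)) ≃L[ℝ] EuclideanSpace ℝ (Fin m) :=
    (ContinuousLinearEquiv.prodComm ℝ _ _).trans (hs (𝒢.unit x)).equiv.symm
  have hex : ∀ h : 𝒢.Isotropy x, ∃ e : PartialDiffeomorph (𝓡 m)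
      𝓘(ℝ, EuclideanSpace ℝ (Fin k) × EuclideanSpace ℝ (Fin n)) G
      (EuclideanSpace ℝ (Fin k) × EuclideanSpace ℝ (Fin n)) ∞, 𝒢.isotropyIncl x h ∈ e.source ∧
      ∀ g ∈ e.source, 𝒢.source g ∈ c.source ∧ (e g).2 = c (𝒢.source g) := fun h =>
    hs.exists_partialDiffeomorph_snd_eq c (by
      change 𝒢.source h.1 ∈ _
      rw [h.2.1]; exact hxc)
  choose e he hec using hex
  have hrange : ∀ h, ∀ g ∈ (e h).source, g ∈ Set.range (𝒢.isotropyIncl x) ↔ (e h g).2 = 0 := by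
    intro h g hg
    rw [mem_range_isotropyIncl hfix, (hec h g hg).2, ← hcx]
    exact ⟨fun h => by rw [h], fun h' => c.injOn (hec h g hg).1 hxc h'⟩
  let σ : 𝒢.Isotropy x → SliceChart (EuclideanSpace ℝ (Fin k)) (EuclideanSpace ℝ (Fin n))
    (EuclideanSpace ℝ (Fin m)) (𝒢.isotropyIncl x) := fun h => ⟨e h, hrange h⟩
  have hι := 𝒢.isEmbedding_isotropyIncl (x := x)
  let cs := SliceChart.chartedSpace σ hι he
  have hman := SliceChart.isManifold σ hι he
  have himm := SliceChart.isImmersion σ hι he L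
  have hιs : ContMDiff (𝓡 k) (𝓡 m) ∞ (𝒢.isotropyIncl x) := himm.contMDiff
  refine ⟨k, cs, ?_, ⟨himm.isImmersion, hι⟩, fun h => ⟨e h, ⟨he h, fun g hg => (hec h g hg).2,
    fun g hg => (hrange h g hg).2, fun h' hh' => hh', fun h' hh' => ?_⟩,
    fun g hg => (hec h g hg).1⟩⟩
  · refine { hman with contMDiff_mul := ?_, contMDiff_inv := ?_ }
    · intro p
      refine SliceChart.contMDiffAt_of_comp σ hι he ?_
      have hp : 𝒢.source (𝒢.isotropyIncl x p.1) = 𝒢.target (𝒢.isotropyIncl x p.2) :=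
        p.1.2.1.trans p.2.2.2.symm
      obtain ⟨O, f, hO, hpO, hf, hfmul⟩ :=
        𝒢.mul_smooth (𝒢.isotropyIncl x p.1, 𝒢.isotropyIncl x p.2) hp
      have hιι : ContMDiff ((𝓡 k).prod (𝓡 k)) ((𝓡 m).prod (𝓡 m)) ∞
          (Prod.map (𝒢.isotropyIncl x) (𝒢.isotropyIncl x)) := hιs.prodMap hιs
      refine ((hf.contMDiffAt (hO.mem_nhds hpO)).comp p hιι.contMDiffAt).congr_of_eventuallyEq ?_
      filter_upwards [(hO.preimage hιι.continuous).mem_nhds hpO] with q hq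
      exact (hfmul _ hq (q.1.2.1.trans q.2.2.2.symm)).symm
    · intro p
      refine SliceChart.contMDiffAt_of_comp σ hι he ?_
      exact (𝒢.inv_smooth.comp hιs).contMDiffAt
  · exact (σ h).map_apply hh'

end Isotropy

/-! ### Properness and the target map near the isotropy group. -/

section FixedPoint

variable {n m k : ℕ}
    {M : Type*} [TopologicalSpace M] [ChartedSpace (EuclideanSpace ℝ (Fin n)) M]
    {G : Type*} [TopologicalSpace G] [ChartedSpace (EuclideanSpace ℝ (Fin m)) G]
    {𝒢 : LieGroupoid n m M G} {x : M}

/-- A sequence in the source fibre has constant anchor `(x, x)`, so properness gives sequential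
compactness, which is compactness in the metrizable space `G`. -/
theorem LieGroupoid.compactSpace_isotropy [T2Space M] [TopologicalSpace.MetrizableSpace G]
    (hfix : 𝒢.IsFixedPoint x) (hproper : 𝒢.IsProperAt x) : CompactSpace (𝒢.Isotropy x) := by
  let _ := TopologicalSpace.metrizableSpaceMetric G
  have hs : Continuous 𝒢.source := 𝒢.source_submersion.contMDiff.continuous
  have h1 : IsCompact {g | 𝒢.source g = x} := by
    refine IsSeqCompact.isCompact fun a ha => ?_
    have hanchor : (fun i => 𝒢.anchor (a i)) = fun _ => (x, x) :=
      funext fun i => Prod.ext (hfix.target_eq (ha i)) (ha i)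
    obtain ⟨b, φ, hφ, hb⟩ := hproper a (by rw [hanchor]; exact tendsto_const_nhds)
    refine ⟨b, ?_, φ, hφ, hb⟩
    have h2 : Filter.Tendsto (fun i => 𝒢.source (a (φ i))) Filter.atTop (𝓝 (𝒢.source b)) :=
      (hs.tendsto b).comp hb
    simp only [show ∀ i, 𝒢.source (a (φ i)) = x from fun i => ha _] at h2
    exact tendsto_nhds_unique h2 tendsto_const_nhds
  rw [← isCompact_univ_iff, (𝒢.isEmbedding_isotropyIncl (x := x)).isCompact_iff, Set.image_univ]
  convert! h1 using 1
  ext g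
  exact mem_range_isotropyIncl hfix

variable {c : PartialDiffeomorph (𝓡 n) (𝓡 n) M (EuclideanSpace ℝ (Fin n)) ∞}

/-- Otherwise arrows outside `V` with ends tending to `x` would subconverge to an arrow with source
`x`, which lies in the open set `V`. -/
theorem LieGroupoid.IsProperAt.exists_forall_mem [T2Space M]
    (hproper : 𝒢.IsProperAt x) (hfix : 𝒢.IsFixedPoint x)
    (hxc : x ∈ c.source) (hcx : c x = 0) {V : Set G} (hV : IsOpen V)
    (hιV : Set.range (𝒢.isotropyIncl x) ⊆ V) :
    ∃ R > 0, ∀ g, 𝒢.source g ∈ c.source → 𝒢.target g ∈ c.source → ‖c (𝒢.source g)‖ < R →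
      ‖c (𝒢.target g)‖ < R → g ∈ V := by
  by_contra! hcon
  have hpos : ∀ i : ℕ, (0 : ℝ) < 1 / ((i : ℝ) + 1) := fun i => Nat.one_div_pos_of_nat
  choose a hs ht hsn htn hV' using fun i : ℕ => hcon _ (hpos i)
  have h0 : (0 : EuclideanSpace ℝ (Fin n)) ∈ c.target := by rw [← hcx]; exact c.map_source hxc
  have hc0 : c.symm 0 = x := by rw [← hcx]; exact c.left_inv hxc
  have hcont : ContinuousAt c.symm 0 :=
    c.contMDiffOn_invFun.continuousOn.continuousAt (c.open_target.mem_nhds h0)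
  have key : ∀ y : ℕ → M, (∀ i, y i ∈ c.source) → (∀ i, ‖c (y i)‖ < 1 / ((i : ℝ) + 1)) →
      Filter.Tendsto y Filter.atTop (𝓝 x) := by
    intro y hy hyn
    have h1 : Filter.Tendsto (fun i => c (y i)) Filter.atTop (𝓝 0) :=
      squeeze_zero_norm (fun i => (hyn i).le) tendsto_one_div_add_atTop_nhds_zero_nat
    have h2 := hcont.tendsto.comp h1
    rw [hc0] at h2
    refine h2.congr fun i => ?_
    exact c.left_inv (hy i)
  have hs' := key _ hs hsn
  obtain ⟨b, φ, hφ, hb⟩ := hproper a ((key _ ht htn).prodMk_nhds hs')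
  have hscont : Continuous 𝒢.source := 𝒢.source_submersion.contMDiff.continuous
  have hsb : 𝒢.source b = x :=
    tendsto_nhds_unique ((hscont.tendsto b).comp hb) (hs'.comp hφ.tendsto_atTop)
  have hbV : b ∈ V := hιV ((mem_range_isotropyIncl hfix).2 hsb)
  obtain ⟨i, hi⟩ := (hb.eventually (hV.mem_nhds hbV)).exists
  exact hV' _ hi

variable [ChartedSpace (EuclideanSpace ℝ (Fin k)) (𝒢.Isotropy x)]

variable (𝒢 x c k) in
/-- Around each point of the isotropy group at `x` there is an adapted chart. -/
def LieGroupoid.HasAdaptedCharts : Prop :=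
  ∀ h : 𝒢.Isotropy x,
    ∃ e : PartialDiffeomorph (𝓡 m)
        𝓘(ℝ, EuclideanSpace ℝ (Fin k) × EuclideanSpace ℝ (Fin n)) G
        (EuclideanSpace ℝ (Fin k) × EuclideanSpace ℝ (Fin n)) ∞,
      IsAdaptedChart (𝒢.isotropyIncl x) (fun g => c (𝒢.source g)) h e ∧
      ∀ g ∈ e.source, 𝒢.source g ∈ c.source

/-- In an adapted chart, with coordinates `(a, z)`, the target map is bounded below by a multiple
of `‖z‖`. -/
theorem LieGroupoid.HasAdaptedCharts.eventually_norm_snd_le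
    (hA : 𝒢.HasAdaptedCharts k x c) (hxc : x ∈ c.source) (hcx : c x = 0)
    (h : 𝒢.Isotropy x)
    {e : PartialDiffeomorph (𝓡 m) 𝓘(ℝ, EuclideanSpace ℝ (Fin k) × EuclideanSpace ℝ (Fin n)) G
      (EuclideanSpace ℝ (Fin k) × EuclideanSpace ℝ (Fin n)) ∞}
    (he : IsAdaptedChart (𝒢.isotropyIncl x) (fun g => c (𝒢.source g)) h e) :
    ∃ C : ℝ, ∀ᶠ p in 𝓝 (e (𝒢.isotropyIncl x h)), ‖p.2‖ ≤ C * ‖c (𝒢.target (e.symm p))‖ := by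
  -- Inversion exchanges source and target: if `q` is the coordinate of `g⁻¹` around `h⁻¹`, then `c
  -- (s g) = T q` and `c (t g) = q.2`. As `T` is Lipschitz and vanishes where the second coordinate
  -- does, `‖c (s g)‖ ≤ C * ‖c (t g)‖`.
  obtain ⟨e', he', hec'⟩ := hA h⁻¹
  have hsc : Continuous 𝒢.source := 𝒢.source_submersion.contMDiff.continuous
  have htc : Continuous 𝒢.target := 𝒢.target_submersion.contMDiff.continuous
  let h' := 𝒢.isotropyIncl x h⁻¹
  let T : EuclideanSpace ℝ (Fin k) × EuclideanSpace ℝ (Fin n) → EuclideanSpace ℝ (Fin n) :=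
    fun q => c (𝒢.target (e'.symm q))
  have hT : ContDiffAt ℝ 1 T (e' h') := by
    have hq : e' h' ∈ e'.target := e'.map_source he'.mem_source
    have h1 : e'.symm (e' h') = h' := e'.left_inv he'.mem_source
    have h2 : 𝒢.target (e'.symm (e' h')) ∈ c.source := by
      rw [h1]; change 𝒢.target h⁻¹.1 ∈ c.source
      rw [h⁻¹.2.2]; exact hxc
    refine ContDiffAt.of_le ?_ (show (1 : WithTop ℕ∞) ≤ ∞ by simp)
    rw [← contMDiffAt_iff_contDiffAt]
    exact ContMDiffAt.comp (g := c) (f := 𝒢.target ∘ e'.symm) _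
      (c.contMDiffOn_toFun.contMDiffAt (c.open_source.mem_nhds h2))
      (ContMDiffAt.comp (g := 𝒢.target) (f := e'.symm) _ 𝒢.target_submersion.contMDiff.contMDiffAt
        (e'.contMDiffOn_invFun.contMDiffAt (e'.open_target.mem_nhds hq)))
  obtain ⟨C, t, ht, hLip⟩ := hT.exists_lipschitzOnWith
  refine ⟨C, ?_⟩
  have hp0 : e (𝒢.isotropyIncl x h) ∈ e.target := e.map_source he.mem_source
  have hes : e.symm (e (𝒢.isotropyIncl x h)) = 𝒢.isotropyIncl x h := e.left_inv he.mem_source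
  have hc1 : ContinuousAt (fun p => 𝒢.inv (e.symm p)) (e (𝒢.isotropyIncl x h)) :=
    𝒢.inv_smooth.continuous.continuousAt.comp
      (e.contMDiffOn_invFun.continuousOn.continuousAt (e.open_target.mem_nhds hp0))
  have hinv : 𝒢.inv (e.symm (e (𝒢.isotropyIncl x h))) = h' := by rw [hes]; rfl
  have hc2 : ContinuousAt (fun p => e' (𝒢.inv (e.symm p))) (e (𝒢.isotropyIncl x h)) := by
    refine ContinuousAt.comp (g := e') ?_ hc1
    rw [hinv]
    exact e'.contMDiffOn_toFun.continuousOn.continuousAt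
      (e'.open_source.mem_nhds he'.mem_source)
  have hc3 : ContinuousAt (fun p => ((e' (𝒢.inv (e.symm p))).1, (0 : EuclideanSpace ℝ (Fin n))))
      (e (𝒢.isotropyIncl x h)) := (continuousAt_fst.comp hc2).prodMk continuousAt_const
  have hval : e' h' = ((e' h').1, 0) := by
    rw [show e' h' = _ from he'.apply_eq _ he'.mem_source]
  have ev1 : ∀ᶠ p in 𝓝 (e (𝒢.isotropyIncl x h)), 𝒢.inv (e.symm p) ∈ e'.source :=
    hc1.eventually (by simp only [hinv]; exact e'.open_source.mem_nhds he'.mem_source)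
  have ev2 : ∀ᶠ p in 𝓝 (e (𝒢.isotropyIncl x h)), e' (𝒢.inv (e.symm p)) ∈ t :=
    hc2.eventually (by simp only [hinv]; exact ht)
  have ev3 : ∀ᶠ p in 𝓝 (e (𝒢.isotropyIncl x h)),
      ((e' (𝒢.inv (e.symm p))).1, (0 : EuclideanSpace ℝ (Fin n))) ∈ t ∩ e'.target :=
    hc3.eventually (by
      simp only [hinv]
      rw [← hval]
      exact Filter.inter_mem ht (e'.open_target.mem_nhds (e'.map_source he'.mem_source)))
  filter_upwards [ev1, ev2, ev3, e.open_target.mem_nhds hp0] with p h1 h2 h3 h4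
  set g := e.symm p with hg
  have hges : g ∈ e.source := e.map_target h4
  have hp2 : p.2 = c (𝒢.source g) := by
    rw [← he.snd_eq g hges]
    exact (congrArg Prod.snd (e.right_inv h4)).symm
  set q := e' (𝒢.inv g)
  have hq2 : q.2 = c (𝒢.target g) := by
    rw [← 𝒢.source_inv]
    exact he'.snd_eq _ h1
  have hTq : T q = p.2 := by
    change c (𝒢.target (e'.symm (e' (𝒢.inv g)))) = _
    rw [show e'.symm (e' (𝒢.inv g)) = _ from e'.left_inv h1, 𝒢.target_inv, hp2]
  have hTq0 : T (q.1, 0) = 0 := by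
    have h5 : e'.symm (q.1, 0) ∈ e'.source := e'.map_target h3.2
    have h6 : e' (e'.symm (q.1, 0)) = (q.1, 0) := e'.right_inv h3.2
    obtain ⟨h'', hh''⟩ := he'.mem_range _ h5 (by rw [h6])
    change c (𝒢.target (e'.symm (q.1, 0))) = 0
    rw [← hh'', show 𝒢.target (𝒢.isotropyIncl x h'') = x from h''.2.2, hcx]
  have := hLip.dist_le_mul q h2 (q.1, 0) h3.1
  rw [hTq, hTq0, dist_zero_right, dist_eq_norm] at this
  have h7 : q - (q.1, 0) = (0, q.2) := by ext <;> simp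
  rw [h7, hq2] at this
  simpa [Prod.norm_def] using this

/-- The target map is radially nondecreasing near a point of the isotropy group. -/
theorem LieGroupoid.HasAdaptedCharts.exists_radial
    (hA : 𝒢.HasAdaptedCharts k x c) (hxc : x ∈ c.source) (hcx : c x = 0)
    {V₀ : Set G} (hV₀ : IsOpen V₀) (h : 𝒢.Isotropy x) (hV₀h : 𝒢.isotropyIncl x h ∈ V₀) :
    ∃ V δ, IsOpen V ∧ 0 < δ ∧ 𝒢.isotropyIncl x h ∈ V ∧ V ⊆ V₀ ∧
      ∀ g ∈ V, 𝒢.source g ∈ c.source ∧ 𝒢.target g ∈ c.source ∧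
        ∀ z : EuclideanSpace ℝ (Fin n), ‖z‖ < δ → ∀ l ∈ Set.Icc (0 : ℝ) 1,
          c (𝒢.source g) = l • z →
          ∃ g' ∈ V, c (𝒢.source g') = z ∧ ‖c (𝒢.target g)‖ ≤ ‖c (𝒢.target g')‖ := by
  obtain ⟨e, he, hec⟩ := hA h
  have htc : Continuous 𝒢.target := 𝒢.target_submersion.contMDiff.continuous
  let T : EuclideanSpace ℝ (Fin k) × EuclideanSpace ℝ (Fin n) → EuclideanSpace ℝ (Fin n) :=
    fun q => c (𝒢.target (e.symm q))
  let W := V₀ ∩ 𝒢.target ⁻¹' c.source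
  have hW : IsOpen W := hV₀.inter (c.open_source.preimage htc)
  let O := e.target ∩ e.symm ⁻¹' W
  have hO : IsOpen O := e.contMDiffOn_invFun.continuousOn.isOpen_inter_preimage e.open_target hW
  have hT : ContDiffOn ℝ ∞ T O := by
    rw [← contMDiffOn_iff_contDiffOn]
    exact c.contMDiffOn_toFun.comp (𝒢.target_submersion.contMDiff.comp_contMDiffOn
      (e.contMDiffOn_invFun.mono Set.inter_subset_left)) fun q hq => hq.2.2
  obtain ⟨C, hC⟩ := hA.eventually_norm_snd_le hxc hcx h he
  have he0 := he.apply_eq h he.mem_source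
  have hmem : e (𝒢.isotropyIncl x h) ∈ O := by
    refine ⟨e.map_source he.mem_source, ?_⟩
    change e.symm (e (𝒢.isotropyIncl x h)) ∈ W
    rw [show e.symm (e (𝒢.isotropyIncl x h)) = _ from e.left_inv he.mem_source]
    refine ⟨hV₀h, ?_⟩
    change 𝒢.target h.1 ∈ c.source
    rw [h.2.2]; exact hxc
  rw [he0] at hmem hC
  have hT0 : ∀ a, (a, (0 : EuclideanSpace ℝ (Fin n))) ∈ O → T (a, 0) = 0 := by
    intro a ha
    have h1 : e.symm (a, 0) ∈ e.source := e.map_target ha.1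
    have h2 : e (e.symm (a, 0)) = (a, 0) := e.right_inv ha.1
    obtain ⟨h', hh'⟩ := he.mem_range _ h1 (by rw [h2])
    change c (𝒢.target (e.symm (a, 0))) = 0
    rw [← hh', show 𝒢.target (𝒢.isotropyIncl x h') = x from h'.2.2, hcx]
  obtain ⟨ε, hε, hball, hmono⟩ := exists_norm_le_norm_of_ray hO hT hmem hT0 hC
  -- In a product of balls the second coordinate can be replaced by any `z` with `‖z‖ < ε` while the
  -- first is kept, so `ε` serves as `δ`.
  refine ⟨e.source ∩ e ⁻¹' (Metric.ball (chartAt (EuclideanSpace ℝ (Fin k)) h h) ε ×ˢ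
    Metric.ball 0 ε), ε, ?_, hε, ?_, ?_, ?_⟩
  · exact e.contMDiffOn_toFun.continuousOn.isOpen_inter_preimage e.open_source
      (Metric.isOpen_ball.prod Metric.isOpen_ball)
  · refine ⟨he.mem_source, ?_⟩
    rw [Set.mem_preimage, he0]
    exact ⟨Metric.mem_ball_self hε, Metric.mem_ball_self hε⟩
  · intro g hg
    have := (hball hg.2).2.1
    rwa [show e.symm (e g) = g from e.left_inv hg.1] at this
  · intro g hg
    have hg1 := (hball hg.2).2.2
    have hgg : e.symm (e g) = g := e.left_inv hg.1
    change 𝒢.target (e.symm (e g)) ∈ c.source at hg1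
    rw [hgg] at hg1
    refine ⟨hec g hg.1, hg1, fun z hz l hl hlz => ?_⟩
    have hzb : ((e g).1, z) ∈ Metric.ball (chartAt (EuclideanSpace ℝ (Fin k)) h h) ε ×ˢ
      Metric.ball (0 : EuclideanSpace ℝ (Fin n)) ε := ⟨hg.2.1, by simpa using hz⟩
    have hzO := hball hzb
    have hg's : e.symm ((e g).1, z) ∈ e.source := e.map_target hzO.1
    have hg'e : e (e.symm ((e g).1, z)) = ((e g).1, z) := e.right_inv hzO.1
    refine ⟨e.symm ((e g).1, z), ⟨hg's, ?_⟩, ?_, ?_⟩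
    · rwa [Set.mem_preimage, hg'e]
    · rw [← he.snd_eq _ hg's, hg'e]
    · have := hmono (e g).1 hg.2.1 z hzb.2 l hl
      have h2 : (e g).2 = l • z := by rw [he.snd_eq g hg.1, hlz]
      rw [← h2] at this
      change ‖c (𝒢.target (e.symm (e g)))‖ ≤ _ at this
      rwa [hgg] at this

/-- The target map is radially nondecreasing near a compact isotropy group. -/
theorem LieGroupoid.HasAdaptedCharts.exists_radial_of_compactSpace [CompactSpace (𝒢.Isotropy x)]
    (hA : 𝒢.HasAdaptedCharts k x c) (hxc : x ∈ c.source) (hcx : c x = 0)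
    {V₀ : Set G} (hV₀ : IsOpen V₀) (hιV₀ : Set.range (𝒢.isotropyIncl x) ⊆ V₀) :
    ∃ V δ, IsOpen V ∧ 0 < δ ∧ Set.range (𝒢.isotropyIncl x) ⊆ V ∧ V ⊆ V₀ ∧
      ∀ g ∈ V, 𝒢.source g ∈ c.source ∧ 𝒢.target g ∈ c.source ∧
        ∀ z : EuclideanSpace ℝ (Fin n), ‖z‖ < δ → ∀ l ∈ Set.Icc (0 : ℝ) 1,
          c (𝒢.source g) = l • z →
          ∃ g' ∈ V, c (𝒢.source g') = z ∧ ‖c (𝒢.target g)‖ ≤ ‖c (𝒢.target g')‖ := by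
  rw [← Set.image_univ]
  refine isCompact_univ.induction_on
    (p := fun S => ∃ V δ, IsOpen V ∧ 0 < δ ∧ 𝒢.isotropyIncl x '' S ⊆ V ∧ V ⊆ V₀ ∧
      ∀ g ∈ V, 𝒢.source g ∈ c.source ∧ 𝒢.target g ∈ c.source ∧
        ∀ z : EuclideanSpace ℝ (Fin n), ‖z‖ < δ → ∀ l ∈ Set.Icc (0 : ℝ) 1,
          c (𝒢.source g) = l • z →
          ∃ g' ∈ V, c (𝒢.source g') = z ∧ ‖c (𝒢.target g)‖ ≤ ‖c (𝒢.target g')‖) ?_ ?_ ?_ ?_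
  · exact ⟨∅, 1, isOpen_empty, one_pos, by simp, by simp, by simp⟩
  · rintro S S' hSS' ⟨V, δ, h1, h2, h3, h4⟩
    exact ⟨V, δ, h1, h2, (Set.image_mono hSS').trans h3, h4⟩
  · rintro S S' ⟨V, δ, hV, hδ, hSV, hVV, h⟩ ⟨V', δ', hV', hδ', hSV', hVV', h'⟩
    refine ⟨V ∪ V', min δ δ', hV.union hV', lt_min hδ hδ', ?_, Set.union_subset hVV hVV', ?_⟩
    · rw [Set.image_union]; exact Set.union_subset_union hSV hSV'
    · rintro g (hg | hg)
      · obtain ⟨h1, h2, h3⟩ := h g hg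
        refine ⟨h1, h2, fun z hz l hl hlz => ?_⟩
        obtain ⟨g', hg', hh⟩ := h3 z (hz.trans_le (min_le_left _ _)) l hl hlz
        exact ⟨g', Or.inl hg', hh⟩
      · obtain ⟨h1, h2, h3⟩ := h' g hg
        refine ⟨h1, h2, fun z hz l hl hlz => ?_⟩
        obtain ⟨g', hg', hh⟩ := h3 z (hz.trans_le (min_le_right _ _)) l hl hlz
        exact ⟨g', Or.inr hg', hh⟩
  · intro h _
    obtain ⟨V, δ, hV, hδ, hhV, hVV, hrad⟩ :=
      hA.exists_radial hxc hcx hV₀ h (hιV₀ ⟨h, rfl⟩)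
    refine ⟨𝒢.isotropyIncl x ⁻¹' V, mem_nhdsWithin_of_mem_nhds ?_, V, δ, hV, hδ,
      Set.image_preimage_subset _ _, hVV, hrad⟩
    exact (hV.preimage 𝒢.isEmbedding_isotropyIncl.continuous).mem_nhds hhV

end FixedPoint

/-! ### Covering of nearby slices. -/

/-- An injective local homeomorphism near `ι K`, with `K` compact, covers the slices `K × z` for `z`
near a point whose slice it covers. -/
theorem eventually_forall_exists_mem_eq {K B G : Type*} [TopologicalSpace K] [CompactSpace K]
    [TopologicalSpace B] [TopologicalSpace G] {f : G → K × B} {Q : Set G} (hQ : IsOpen Q)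
    (hf : IsLocalHomeomorphOn f Q) {z₀ : B} (hz₀ : ∀ h, ∃ g ∈ Q, f g = (h, z₀)) :
    ∀ᶠ z in 𝓝 z₀, ∀ h, ∃ g ∈ Q, f g = (h, z) := by
  -- By the tube lemma it suffices that the image of `Q` is a neighbourhood of each `(h, z₀)`, and
  -- `f` is open on `Q`.
  have := isCompact_univ.eventually_forall_of_forall_eventually (x₀ := z₀) (K := (Set.univ : Set K))
    (P := fun z h => ∃ g ∈ Q, f g = (h, z)) fun h _ => ?_
  · simpa using this
  · obtain ⟨g, hg, hgz⟩ := hz₀ h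
    have h1 : f '' Q ∈ 𝓝 (h, z₀) := by
      rw [← hgz, ← hf.map_nhds_eq hg]
      exact Filter.image_mem_map (hQ.mem_nhds hg)
    exact (continuous_swap.tendsto' (z₀, h) (h, z₀) rfl).eventually h1

theorem isOpen_setOf_isLocalDiffeomorphAt {E₁ E₂ H₁ H₂ M₁ M₂ : Type*} [NormedAddCommGroup E₁]
    [NormedSpace ℝ E₁] [TopologicalSpace H₁] {I : ModelWithCorners ℝ E₁ H₁} [TopologicalSpace M₁]
    [ChartedSpace H₁ M₁] [NormedAddCommGroup E₂] [NormedSpace ℝ E₂] [TopologicalSpace H₂]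
    {J : ModelWithCorners ℝ E₂ H₂} [TopologicalSpace M₂] [ChartedSpace H₂ M₂] (f : M₁ → M₂) :
    IsOpen {x | IsLocalDiffeomorphAt I J ∞ f x} := by
  refine isOpen_iff_mem_nhds.2 ?_
  rintro x ⟨Φ, hx, hΦ⟩
  filter_upwards [Φ.open_source.mem_nhds hx] with y hy
  exact ⟨Φ, hy, hΦ⟩

/-! ### Trivialization of the source map near the isotropy group. -/

namespace LieGroupoid

variable {n m k : ℕ}
    {M : Type*} [TopologicalSpace M]
    [ChartedSpace (EuclideanSpace ℝ (Fin n)) M]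
    {G : Type*} [TopologicalSpace G] [T2Space G] [SecondCountableTopology G]
    [ChartedSpace (EuclideanSpace ℝ (Fin m)) G] [IsManifold (𝓡 m) ∞ G]
    {𝒢 : LieGroupoid n m M G} {x : M}
    {c : PartialDiffeomorph (𝓡 n) (𝓡 n) M (EuclideanSpace ℝ (Fin n)) ∞}
    [ChartedSpace (EuclideanSpace ℝ (Fin k)) (𝒢.Isotropy x)] [LieGroup (𝓡 k) ∞ (𝒢.Isotropy x)]

/-- A compact isotropy group is a smooth retract of a neighbourhood, by a retraction that maps the
units to the unit. -/
theorem HasAdaptedCharts.exists_isRetractionOn [CompactSpace (𝒢.Isotropy x)]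
    (hA : 𝒢.HasAdaptedCharts k x c) :
    ∃ r V, IsRetractionOn (EuclideanSpace ℝ (Fin k)) (EuclideanSpace ℝ (Fin m))
      (𝒢.isotropyIncl x) r V ∧ (∀ h, 𝒢.isotropyIncl x h ∈ V) ∧ ∀ y, r (𝒢.unit y) = 1 := by
  have : LocallyCompactSpace G := ChartedSpace.locallyCompactSpace (EuclideanSpace ℝ (Fin m)) G
  have hι := 𝒢.isEmbedding_isotropyIncl (x := x)
  have : T2Space (𝒢.Isotropy x) := hι.t2Space
  obtain ⟨r, V, hr, hV⟩ := _root_.exists_isRetractionOn (A := EuclideanSpace ℝ (Fin k))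
    (E := EuclideanSpace ℝ (Fin m)) hι.continuous
    fun h => by
      obtain ⟨e, he, -⟩ := hA h
      exact he.exists_isRetractionOn
  have hus : ContMDiff (𝓡 m) (𝓡 m) ∞ fun g => 𝒢.unit (𝒢.source g) :=
    𝒢.unit_smooth.comp 𝒢.source_submersion.contMDiff
  have hu : ∀ h, 𝒢.unit (𝒢.source (𝒢.isotropyIncl x h)) = 𝒢.isotropyIncl x 1 := fun h => by
    rw [show 𝒢.source (𝒢.isotropyIncl x h) = x from h.2.1]; rfl
  -- The added factor normalizes the units; on `G_x` it is `r (1_x)⁻¹ = 1`.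
  refine ⟨fun g => (r (𝒢.unit (𝒢.source g)))⁻¹ * r g,
    V ∩ (fun g => 𝒢.unit (𝒢.source g)) ⁻¹' V, ⟨hr.isOpen.inter (hr.isOpen.preimage hus.continuous),
      ?_, ?_⟩, fun h => ⟨hV h, ?_⟩, fun y => ?_⟩
  · exact (hr.contMDiffOn.comp hus.contMDiffOn fun g hg => hg.2).inv.mul
      (hr.contMDiffOn.mono Set.inter_subset_left)
  · intro h hh
    simp only [hu, hr.apply_eq _ (hV _), inv_one, one_mul]
  · rw [Set.mem_preimage, hu]
    exact hV 1
  · simp only [𝒢.source_unit, inv_mul_cancel]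

/-- The trivialization of the source map along a compact isotropy group. -/
theorem HasAdaptedCharts.exists_trivialization [CompactSpace (𝒢.Isotropy x)]
    (hA : 𝒢.HasAdaptedCharts k x c) (hxc : x ∈ c.source)
    (hcx : c x = 0) :
    ∃ (r : G → 𝒢.Isotropy x) (V : Set G) (δ : ℝ),
      (∀ h, r (𝒢.isotropyIncl x h) = h) ∧ (∀ y, r (𝒢.unit y) = 1) ∧
      IsOpen V ∧ Set.range (𝒢.isotropyIncl x) ⊆ V ∧
      (∀ g ∈ V, 𝒢.source g ∈ c.source ∧ 𝒢.target g ∈ c.source) ∧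
      (∀ g ∈ V, IsLocalDiffeomorphAt (𝓡 m) ((𝓡 k).prod (𝓡 n)) ∞
        (fun g => (r g, c (𝒢.source g))) g) ∧
      Set.InjOn (fun g => (r g, c (𝒢.source g))) V ∧ 0 < δ ∧
      ∀ g ∈ V, ∀ z : EuclideanSpace ℝ (Fin n), ‖z‖ < δ → ∀ l ∈ Set.Icc (0 : ℝ) 1,
        c (𝒢.source g) = l • z →
        ∃ g' ∈ V, c (𝒢.source g') = z ∧ ‖c (𝒢.target g)‖ ≤ ‖c (𝒢.target g')‖ := by
  have hι := 𝒢.isEmbedding_isotropyIncl (x := x)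
  have : T2Space (𝒢.Isotropy x) := hι.t2Space
  obtain ⟨r, V₁, hr, hV₁, hr1⟩ := hA.exists_isRetractionOn
  let f : G → 𝒢.Isotropy x × EuclideanSpace ℝ (Fin n) := fun g => (r g, c (𝒢.source g))
  have hfι : ∀ h, f (𝒢.isotropyIncl x h) = (h, 0) := fun h =>
    Prod.ext (hr.apply_eq h (hV₁ h)) (by
      change c (𝒢.source (𝒢.isotropyIncl x h)) = 0
      rw [show 𝒢.source (𝒢.isotropyIncl x h) = x from h.2.1, hcx])
  have hloc : ∀ h, IsLocalDiffeomorphAt (𝓡 m) ((𝓡 k).prod (𝓡 n)) ∞ f (𝒢.isotropyIncl x h) := by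
    intro h
    obtain ⟨e, he, -⟩ := hA h
    exact he.isLocalDiffeomorphAt hr (hV₁ h)
  have hinj : Set.InjOn f (Set.range (𝒢.isotropyIncl x)) := by
    rintro _ ⟨h, rfl⟩ _ ⟨h', rfl⟩ he
    rw [hfι, hfι] at he
    exact congrArg (𝒢.isotropyIncl x) (congrArg Prod.fst he)
  have hcomp : IsCompact (Set.range (𝒢.isotropyIncl x)) := isCompact_range hι.continuous
  obtain ⟨t, ht, htinj⟩ := hinj.exists_mem_nhdsSet hcomp
    (by rintro _ ⟨h, rfl⟩; exact (hloc h).contMDiffAt.continuousAt) (by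
      rintro _ ⟨h, rfl⟩
      obtain ⟨Φ, hh, hΦ⟩ := hloc h
      exact ⟨Φ.source, Φ.open_source.mem_nhds hh, Φ.injOn.congr hΦ.symm⟩)
  obtain ⟨V₂, hV₂, hιV₂, hV₂t⟩ := mem_nhdsSet_iff_exists.1 ht
  obtain ⟨V, δ, hV, hδ, hιV, hVV, hrad⟩ := hA.exists_radial_of_compactSpace hxc hcx
    (hV₂.inter (isOpen_setOf_isLocalDiffeomorphAt (I := 𝓡 m) (J := (𝓡 k).prod (𝓡 n)) f))
    (Set.subset_inter hιV₂ (by rintro _ ⟨h, rfl⟩; exact hloc h))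
  exact ⟨r, V, δ, fun h => hr.apply_eq h (hV₁ h), hr1, hV, hιV,
    fun g hg => ⟨(hrad g hg).1, (hrad g hg).2.1⟩, fun g hg => (hVV hg).2,
    htinj.mono fun g hg => hV₂t (hVV hg).1, hδ, fun g hg => (hrad g hg).2.2⟩

end LieGroupoid

/-! ### The saturated neighbourhood and its trivialization. -/

set_option maxHeartbeats 800000 in
theorem mainTheorem9 {n m : ℕ}
    {M : Type*} [TopologicalSpace M] [T2Space M] [SecondCountableTopology M]
    [ChartedSpace (EuclideanSpace ℝ (Fin n)) M] [IsManifold (𝓡 n) ∞ M]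
    {G : Type*} [TopologicalSpace G] [T2Space G] [SecondCountableTopology G]
    [ChartedSpace (EuclideanSpace ℝ (Fin m)) G] [IsManifold (𝓡 m) ∞ G]
    (𝒢 : LieGroupoid n m M G) (x : M)
    (hfix : 𝒢.IsFixedPoint x) (hproper : 𝒢.IsProperAt x) :
    ∃ (k : ℕ) (_ : ChartedSpace (EuclideanSpace ℝ (Fin k)) (𝒢.Isotropy x)),
      LieGroup (𝓡 k) ∞ (𝒢.Isotropy x) ∧
      Manifold.IsSmoothEmbedding (𝓡 k) (𝓡 m) ∞ (𝒢.isotropyIncl x) ∧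
      ∃ W : TopologicalSpace.Opens M, x ∈ W ∧
        ∀ W' : TopologicalSpace.Opens M, x ∈ W' →
          ∃ (U : TopologicalSpace.Opens M) (hx : x ∈ U), U ≤ W' ∧
            𝒢.IsSaturatedIn (U : Set M) (W : Set M) ∧
            ∃ (ψ : Diffeomorph (𝓡 n) (𝓡 n) U (EuclideanSpace ℝ (Fin n)) ∞)
              (Φ : Diffeomorph (𝓡 m) ((𝓡 k).prod (𝓡 n)) (𝒢.restrict U)
                (𝒢.Isotropy x × EuclideanSpace ℝ (Fin n)) ∞),
              (∀ g : 𝒢.Isotropy x, Φ (𝒢.isotropyToRestrict U hx g) = (g, 0)) ∧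
              (∀ g : 𝒢.restrict U, (Φ g).2 = ψ (𝒢.restrictSource U g)) ∧
              (∀ y : U, Φ (𝒢.restrictUnit U y) = (1, ψ y)) := by
  obtain ⟨c, hxc, hcx⟩ := exists_partialDiffeomorph_apply_eq_zero (n := n) x
  obtain ⟨k, cs, hlie, hemb, hA⟩ := LieGroupoid.exists_lieGroup_isotropy hfix c hxc hcx
  refine ⟨k, cs, hlie, hemb, ?_⟩
  have hscont : Continuous 𝒢.source := 𝒢.source_submersion.contMDiff.continuous
  have htcont : Continuous 𝒢.target := 𝒢.target_submersion.contMDiff.continuous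
  have : LocallyCompactSpace G := ChartedSpace.locallyCompactSpace (EuclideanSpace ℝ (Fin m)) G
  have : TopologicalSpace.MetrizableSpace G := Manifold.metrizableSpace (𝓡 m) G
  have : CompactSpace (𝒢.Isotropy x) := LieGroupoid.compactSpace_isotropy hfix hproper
  obtain ⟨r, V, δ, hrι, hr1, hV, hιV, hVc, hVloc, hVinj, hδ, hrad⟩ :=
    LieGroupoid.HasAdaptedCharts.exists_trivialization hA hxc hcx
  set f : G → 𝒢.Isotropy x × EuclideanSpace ℝ (Fin n) := fun g => (r g, c (𝒢.source g)) with hf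
  have hfι : ∀ h, f (𝒢.isotropyIncl x h) = (h, 0) := fun h => Prod.ext (hrι h) (by
    change c (𝒢.source (𝒢.isotropyIncl x h)) = 0
    rw [show 𝒢.source (𝒢.isotropyIncl x h) = x from h.2.1, hcx])
  -- the arrows of `V` whose target lies in a given ball
  let Q : ℝ → Set G := fun ρ => V ∩ 𝒢.target ⁻¹' (c.source ∩ c ⁻¹' Metric.ball 0 ρ)
  have hball : ∀ S : Set (EuclideanSpace ℝ (Fin n)), IsOpen S → IsOpen (c.source ∩ c ⁻¹' S) :=
    fun S hS => c.contMDiffOn_toFun.continuousOn.isOpen_inter_preimage c.open_source hS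
  have hQ : ∀ ρ, IsOpen (Q ρ) := fun ρ => hV.inter ((hball _ Metric.isOpen_ball).preimage htcont)
  have hQloc : ∀ ρ, IsLocalHomeomorphOn f (Q ρ) := fun ρ =>
    IsLocalDiffeomorphOn.isLocalHomeomorphOn (I := 𝓡 m) (J := (𝓡 k).prod (𝓡 n)) (n := ∞)
      fun g => hVloc g g.2.1
  have hQι : ∀ ρ > 0, ∀ h, ∃ g ∈ Q ρ, f g = (h, 0) := by
    refine fun ρ hρ h => ⟨𝒢.isotropyIncl x h, ⟨hιV ⟨h, rfl⟩, ?_⟩, hfι h⟩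
    rw [Set.mem_preimage, show 𝒢.target (𝒢.isotropyIncl x h) = x from h.2.2]
    exact ⟨hxc, by simpa [hcx] using hρ⟩
  have hsrc : ∀ g, 𝒢.source g ∈ c.source → c (𝒢.source g) = 0 → 𝒢.source g = x :=
    fun g hg h => c.injOn hg hxc (by rw [hcx]; exact h)
  obtain ⟨R₀, hR₀, hVR₀⟩ := hproper.exists_forall_mem hfix hxc hcx hV hιV
  have hct : c.target ∈ 𝓝 (0 : EuclideanSpace ℝ (Fin n)) :=
    c.open_target.mem_nhds (by rw [← hcx]; exact c.map_source hxc)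
  obtain ⟨R₁, hR₁, hR₁Q⟩ := Metric.eventually_nhds_iff_ball.1
    ((eventually_forall_exists_mem_eq (hQ R₀) (hQloc R₀) (hQι R₀ hR₀)).and hct)
  -- Below `R₁` the slices are filled by arrows of `Q R₀`; arrows with both ends below `R₀` lie in
  -- `V`; below `δ` radial comparison is possible.
  let R := min R₁ (min R₀ δ)
  have hR : 0 < R := lt_min hR₁ (lt_min hR₀ hδ)
  have hRR₁ : R ≤ R₁ := min_le_left _ _
  have hRR₀ : R ≤ R₀ := (min_le_right _ _).trans (min_le_left _ _)
  have hRδ : R ≤ δ := (min_le_right _ _).trans (min_le_right _ _)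
  have hslice : ∀ z : EuclideanSpace ℝ (Fin n), ‖z‖ < R → ∀ h, ∃ g ∈ Q R₀, f g = (h, z) :=
    fun z hz => (hR₁Q z (by simpa using hz.trans_le hRR₁)).1
  have htarget : ∀ z : EuclideanSpace ℝ (Fin n), ‖z‖ < R → z ∈ c.target :=
    fun z hz => (hR₁Q z (by simpa using hz.trans_le hRR₁)).2
  -- Arrows of `Q R₀` already fill the slice over the source of `g`, and injectivity of `f` leaves
  -- no room for others in `V`.
  have htR₀ : ∀ g ∈ V, ‖c (𝒢.source g)‖ < R → ‖c (𝒢.target g)‖ < R₀ := by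
    intro g hg hgR
    obtain ⟨g', hg', he⟩ := hslice _ hgR (r g)
    rw [← hVinj hg'.1 hg he]
    simpa using hg'.2.2
  let W : TopologicalSpace.Opens M := ⟨c.source ∩ c ⁻¹' Metric.ball 0 R, hball _ Metric.isOpen_ball⟩
  have hmemW : ∀ y, y ∈ W ↔ y ∈ c.source ∧ ‖c y‖ < R := fun y => by
    change y ∈ c.source ∧ c y ∈ Metric.ball 0 R ↔ _
    rw [mem_ball_zero_iff]
  refine ⟨W, (hmemW x).2 ⟨hxc, by simpa [hcx] using hR⟩, fun W' hxW' => ?_⟩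
  obtain ⟨ρ, hρ, hρR, hρW'⟩ : ∃ ρ > 0, ρ ≤ R ∧ ∀ y ∈ c.source, ‖c y‖ < ρ → y ∈ W' := by
    have hcs : ContinuousAt c.symm (c x) := c.contMDiffOn_invFun.continuousOn.continuousAt
      (c.open_target.mem_nhds (c.map_source hxc))
    have h1 : ∀ᶠ z in 𝓝 (c x), c.symm z ∈ W' := hcs.eventually (by
      rw [show c.symm (c x) = x from c.left_inv hxc]
      exact W'.isOpen.mem_nhds hxW')
    rw [hcx] at h1
    obtain ⟨ε, hε, h2⟩ := Metric.eventually_nhds_iff_ball.1 h1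
    refine ⟨min ε R, lt_min hε hR, min_le_right _ _, fun y hy hyε => ?_⟩
    have := h2 (c y) (by simpa using hyε.trans_le (min_le_left _ _))
    rwa [show c.symm (c y) = y from c.left_inv hy] at this
  -- Only `ρ` depends on `W'`; `R` and `W` were fixed before. Over each `z` with `‖z‖ < R` the
  -- arrows of `V` correspond under `r` to the points of `G_x`, so compactness makes the condition
  -- open.
  let Ω : Set (EuclideanSpace ℝ (Fin n)) :=
    {z | ‖z‖ < R ∧ ∀ g ∈ V, c (𝒢.source g) = z → ‖c (𝒢.target g)‖ < ρ}
  have hΩ : IsOpen Ω := by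
    refine isOpen_iff_mem_nhds.2 fun z hz => ?_
    have h1 : ∀ h, ∃ g ∈ Q ρ, f g = (h, z) := by
      intro h
      obtain ⟨g, hg, hgz⟩ := hslice z hz.1 h
      refine ⟨g, ⟨hg.1, hg.2.1, ?_⟩, hgz⟩
      simpa using hz.2 g hg.1 (congrArg Prod.snd hgz)
    filter_upwards [eventually_forall_exists_mem_eq (hQ ρ) (hQloc ρ) h1,
      continuous_norm.continuousAt.eventually (gt_mem_nhds hz.1)] with w hw hwR
    refine ⟨hwR, fun g hg hgw => ?_⟩
    obtain ⟨g', hg', he⟩ := hw (r g)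
    rw [← hVinj hg'.1 hg (he.trans (Prod.ext rfl hgw.symm))]
    simpa using hg'.2.2
  have hΩρ : ∀ z ∈ Ω, ‖z‖ < ρ := by
    intro z hz
    have hzt := htarget z hz.1
    set y := c.symm z with hy
    have hys : y ∈ c.source := c.map_target hzt
    have hcy : c y = z := c.right_inv hzt
    -- The unit at `y` is an arrow of `V` from `y` to `y`, so the definition of `Ω` bounds `z`
    -- itself.
    have huV : 𝒢.unit y ∈ V := by
      refine hVR₀ _ ?_ ?_ ?_ ?_ <;> simp only [𝒢.source_unit, 𝒢.target_unit, hcy]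
      exacts [hys, hys, hz.1.trans_le hRR₀, hz.1.trans_le hRR₀]
    have := hz.2 _ huV (by rw [𝒢.source_unit, hcy])
    rwa [𝒢.target_unit, hcy] at this
  have h0Ω : (0 : EuclideanSpace ℝ (Fin n)) ∈ Ω := by
    refine ⟨by simpa using hR, fun g hg hg0 => ?_⟩
    rw [hfix.target_eq (hsrc g (hVc g hg).1 hg0), hcx, norm_zero]
    exact hρ
  have hstar : ∀ z ∈ Ω, ∀ l ∈ Set.Icc (0 : ℝ) 1, l • z ∈ Ω := by
    intro z hz l hl
    refine ⟨?_, fun g hg hgz => ?_⟩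
    · rw [norm_smul, Real.norm_eq_abs, abs_of_nonneg hl.1]
      exact (mul_le_of_le_one_left (norm_nonneg _) hl.2).trans_lt hz.1
    · obtain ⟨g', hg', hg'z, hle⟩ := hrad g hg z (hz.1.trans_le hRδ) l hl hgz
      exact hle.trans_lt (hz.2 g' hg' hg'z)
  have hΩb : Bornology.IsBounded Ω :=
    (Metric.isBounded_ball (x := (0 : EuclideanSpace ℝ (Fin n))) (r := ρ)).subset fun z hz =>
      mem_ball_zero_iff.2 (hΩρ z hz)
  obtain ⟨θ, hθ0, hθloc, hθ⟩ := exists_bijOn_univ_of_starShaped hΩ hΩb h0Ω hstar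
  let U : TopologicalSpace.Opens M := ⟨c.source ∩ c ⁻¹' Ω, hball Ω hΩ⟩
  have hUW : ∀ y ∈ U, y ∈ W := fun y hy => (hmemW y).2 ⟨hy.1, hy.2.1⟩
  have hsat : ∀ g : G, 𝒢.source g ∈ U → 𝒢.target g ∈ W → 𝒢.target g ∈ U := by
    intro g hgU hgW
    obtain ⟨hgc, hgR⟩ := (hmemW _).1 hgW
    refine ⟨hgc, hgR, fun g' hg' he => ?_⟩
    have hs : 𝒢.source g' = 𝒢.target g := c.injOn (hVc g' hg').1 hgc he
    have hR' : ‖c (𝒢.target g')‖ < R₀ := htR₀ g' hg' (by rw [hs]; exact hgR)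
    -- The composite starts in `U`, so once it is in `V` its target, which is that of `g'`, is in
    -- the ball of radius `ρ`.
    have hmulV : 𝒢.mul g' g hs ∈ V := by
      refine hVR₀ _ ?_ ?_ ?_ ?_ <;> simp only [𝒢.source_mul, 𝒢.target_mul]
      exacts [hgU.1, (hVc g' hg').2, hgU.2.1.trans_le hRR₀, hR']
    have := hgU.2.2 _ hmulV (by rw [𝒢.source_mul])
    rwa [𝒢.target_mul] at this
  have hxU : x ∈ U := ⟨hxc, by rw [Set.mem_preimage, hcx]; exact h0Ω⟩
  have hUV : ∀ g ∈ 𝒢.restrict U, g ∈ V := fun g hg =>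
    hVR₀ g hg.1.1 hg.2.1 (hg.1.2.1.trans_le hRR₀) (hg.2.2.1.trans_le hRR₀)
  let ψ₀ : U → EuclideanSpace ℝ (Fin n) := fun y => θ (c y)
  have hψloc : IsLocalDiffeomorph (𝓡 n) (𝓡 n) ∞ ψ₀ := fun y =>
    ((isLocalDiffeomorphAt_subtype_val U y).comp _ _
      (c.isLocalDiffeomorphAt _ _ _ y.2.1)).comp _ _ (hθloc _ y.2.2)
  have hψbij : Function.Bijective ψ₀ := by
    refine ⟨fun y y' h => Subtype.ext (c.injOn y.2.1 y'.2.1 (hθ.injOn y.2.2 y'.2.2 h)), fun v => ?_⟩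
    obtain ⟨z, hz, rfl⟩ := hθ.surjOn (Set.mem_univ v)
    have hzt := htarget z hz.1
    have hcy : c (c.symm z) = z := c.right_inv hzt
    refine ⟨⟨c.symm z, c.map_target hzt, ?_⟩, ?_⟩
    · rw [Set.mem_preimage, hcy]; exact hz
    · change θ (c (c.symm z)) = _
      rw [hcy]
  let Φ₀ : 𝒢.restrict U → 𝒢.Isotropy x × EuclideanSpace ℝ (Fin n) :=
    fun g => (r g, θ (c (𝒢.source g)))
  have hΦloc : IsLocalDiffeomorph (𝓡 m) ((𝓡 k).prod (𝓡 n)) ∞ Φ₀ := fun g =>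
    ((isLocalDiffeomorphAt_subtype_val (𝒢.restrict U) g).comp _ _ (hVloc g (hUV g g.2))).comp _ _
      (isLocalDiffeomorphAt_prodMap (f := id) (isLocalDiffeomorphAt_id _) (hθloc _ g.2.1.2))
  have hΦbij : Function.Bijective Φ₀ := by
    refine ⟨fun g g' h => ?_, ?_⟩
    · have h1 : r g = r g' := congrArg Prod.fst h
      have h2 : θ (c (𝒢.source g)) = θ (c (𝒢.source g')) := congrArg Prod.snd h
      exact Subtype.ext (hVinj (hUV g g.2) (hUV g' g'.2)
        (Prod.ext h1 (hθ.injOn g.2.1.2 g'.2.1.2 h2)))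
    rintro ⟨h, v⟩
    obtain ⟨z, hz, rfl⟩ := hθ.surjOn (Set.mem_univ v)
    obtain ⟨g, hg, hgz⟩ := hslice z hz.1 h
    have hgz2 : c (𝒢.source g) = z := congrArg Prod.snd hgz
    have hsU : 𝒢.source g ∈ U := ⟨(hVc g hg.1).1, by rw [Set.mem_preimage, hgz2]; exact hz⟩
    -- The target lies in the ball of radius `ρ ≤ R`, hence in `W`, and saturation brings it into
    -- `U`.
    have htU : 𝒢.target g ∈ U := hsat g hsU
      ((hmemW _).2 ⟨(hVc g hg.1).2, (hz.2 g hg.1 hgz2).trans_le hρR⟩)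
    refine ⟨⟨g, hsU, htU⟩, Prod.ext (congrArg Prod.fst hgz :) ?_⟩
    change θ (c (𝒢.source g)) = _
    rw [hgz2]
  refine ⟨U, hxU, fun y hy => hρW' y hy.1 (hΩρ _ hy.2), ⟨hUW, hsat⟩,
    hψloc.diffeomorphOfBijective hψbij, hΦloc.diffeomorphOfBijective hΦbij, fun h => ?_,
    fun g => rfl, fun y => ?_⟩
  · change (r (𝒢.isotropyIncl x h), θ (c (𝒢.source (𝒢.isotropyIncl x h)))) = (h, 0)
    rw [hrι, show 𝒢.source (𝒢.isotropyIncl x h) = x from h.2.1, hcx, hθ0]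
  · change (r (𝒢.unit y), θ (c (𝒢.source (𝒢.unit y)))) = (1, θ (c y))
    rw [hr1, 𝒢.source_unit]
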